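/- **Theorem (stability of the SFOR nonuniform Alikhanov scheme for the diffusion-wave problem).** *Time mesh and kernels.* Let $1<\alpha<2$, $\beta=\alpha/2$, $\theta=\beta/2$, $T>0$, and let $0=t_0<t_1<\dots<t_N=T$ with $\tau_k=t_k-t_{k-1}$, $\rho_k=\tau_k/\tau_{k+1}$. For a sequence $g$ and $n\ge 1$ write $g^{n-\theta}=(1-\theta)g^n+\theta g^{n-1}$, and $t_{n-\theta}=(1-\theta)t_n+\theta t_{n-1}$. With $\omega_\mu(s)=s^{\mu-1}/\Gamma(\mu)$ let $$a^{(n)}_{n-k}=\frac1{\tau_k}\int_{t_{k-1}}^{\min\{t_k,t_{n-\theta}\}}\omega_{1-\beta}(t_{n-\theta}-s)\,ds\quad(1\le k\le n),$$ $$b^{(n)}_{n-k}=\frac{2}{\tau_k(\tau_k+\tau_{k+1})}\int_{t_{k-1}}^{t_k}\omega_{1-\beta}(t_{n-\theta}-s)\Big(s-\frac{t_{k-1}+t_k}2\Big)ds\quad(1\le k\le n-1).$$ Put $A^{(1)}_0=a^{(1)}_0$ and, for $n\ge2$, $A^{(n)}_0=a^{(n)}_0+\rho_{n-1}b^{(n)}_1$,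 $A^{(n)}_{n-k}=a^{(n)}_{n-k}+\rho_{k-1}b^{(n)}_{n-k+1}-b^{(n)}_{n-k}$ for $2\le k\le n-1$, $A^{(n)}_{n-1}=a^{(n)}_{n-1}-b^{(n)}_{n-1}$. Let $(\mathcal D_\tau^\beta g)^{n-\theta}=\sum_{k=1}^nA^{(n)}_{n-k}(g^k-g^{k-1})$. The complementary kernels are $P^{(n)}_0=1/A^{(n)}_0$ and $P^{(n)}_{n-j}=\frac1{A^{(j)}_0}\sum_{k=j+1}^n\big(A^{(k)}_{k-j-1}-A^{(k)}_{k-j}\big)P^{(n)}_{n-k}$ for $1\le j\le n-1$. *Coefficients.* Let $\Omega=(x_l,x_r)\times(y_l,y_r)$ and $\mathcal A=a_1\partial_{xx}+a_2\partial_{yy}+b_1\partial_x+b_2\partial_y+b_3$ with coefficients depending on $(x,y,t)$, $(x,y)\in\Omega$, $t\in[0,T]$. Assume **V1**: $a_1,a_2>0$ on $\Omega\times[0,T]$; for each $(x,y)\in\Omega$ they are $C^1$ in $t\in[0,T]$; and $|\partial_ta_1/a_1|+|\partial_ta_2/a_2|\le C_p$ for a constant $C_p>0$. Let $d$ be a positive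 continuous function on $\Omega$, and set $p=d\,e^{-C_pt}/(a_1a_2)$, $p_1=p\,a_1$, $p_2=p\,a_2$, $p_3=b_1-p^{-1}\partial_xp_1$, $p_4=b_2-p^{-1}\partial_yp_2$, where the derivatives $\partial_xp_1$, $\partial_yp_2$ are assumed to exist. Assume that for constants $m,K>0$, on $\Omega\times[0,T]$, $m\le p,p_1,p_2\le K$ and $|p_3|,|p_4|,|b_3|\le K$. *Space grid.* For integers $M_x,M_y\ge1$ let $h_x=(x_r-x_l)/M_x$, $h_y=(y_r-y_l)/M_y$, $x_i=x_l+ih_x$, $y_j=y_l+jh_y$ (also for half-integers $i,j$); the interior nodes are $(x_i,y_j)$ with $1\le i\le M_x-1$, $1\le j\le M_y-1$. For grid functions $w$ vanishing at the boundary nodes let $$\|w\|^2=h_xh_y\sum_{i=1}^{M_x-1}\sum_{j=1}^{M_y-1}w_{i,j}^2,\qquad \|\nabla_hw\|^2=\|\delta_xw\|^2+\|\delta_yw\|^2,$$ $$\|\delta_xw\|^2=h_xh_y\sum_{i=0}^{M_x-1}\sum_{j=1}^{M_y-1}\Big(\frac{w_{i+1,j}-w_{i,j}}{h_x}\Big)^2,\qquad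 \|\delta_yw\|^2=h_xh_y\sum_{i=1}^{M_x-1}\sum_{j=0}^{M_y-1}\Big(\frac{w_{i,j+1}-w_{i,j}}{h_y}\Big)^2.$$ With $\delta_x,\delta_y$ the half-step central differences and $\delta_{\hat x}w_{i,j}=(w_{i+1,j}-w_{i-1,j})/(2h_x)$, $\delta_{\hat y}w_{i,j}=(w_{i,j+1}-w_{i,j-1})/(2h_y)$, let $$\mathcal A_h^{n-\theta}=p^{-1}\{\delta_x[p_1\delta_x]+\delta_y[p_2\delta_y]\}+p_3\delta_{\hat x}+p_4\delta_{\hat y}+b_3,$$ all coefficients being taken at time $t_{n-\theta}$ ($p_1$ at $(x_{i\pm1/2},y_j)$ and $p_2$ at $(x_i,y_{j\pm1/2})$). *Scheme.* Let $f$ be a real function of $(x,y,t)$, and let $\varphi,\psi$ be functions on $\overline\Omega$ vanishing on $\partial\Omega$, such that $\psi_x,\psi_{xx},\psi_y,\psi_{yy}$ exist in $\Omega$. Write $f^{n-\theta}$ and $\tilde\psi^{n-\theta}$ for the values of $f$ and of $\mathcal A(t\psi)$ at the nodes and at time $t_{n-\theta}$. Let the grid functions $u^n,v^n$ ($0\le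 n\le N$) have zero boundary values, $u^0=\varphi$ and $v^0=0$ at the interior nodes, and, with $\tilde u^n=u^n-t_n\psi$, satisfy at all interior nodes for $1\le n\le N$ $$(\mathcal D_\tau^\beta v)^{n-\theta}=\mathcal A_h^{n-\theta}\tilde u^{n-\theta}+f^{n-\theta}+\tilde\psi^{n-\theta},\qquad v^{n-\theta}=(\mathcal D_\tau^\beta\tilde u)^{n-\theta}.$$ *Claim.* The scheme is stable in the discrete $H^1$ seminorm, with no condition linking the time steps to the space steps: there are constants $\tau_{\max},C,C'>0$ depending only on $\alpha,T,\Omega,m,K$ such that, for all coefficients and data as above, all $M_x,M_y,N$ and all time meshes with $\rho_k\le 7/4$ ($1\le k\le N-1$) and $\max_k\tau_k\le\tau_{\max}$, every solution of the scheme satisfies for $1\le n\le N$ $$\|\nabla_hu^n\|\le C\Big[\|\nabla_h\varphi\|+t_n\|\nabla_h\psi\|+\max_{1\le k\le n}\sum_{j=1}^kP^{(k)}_{k-j}\big(\|f^{j-\theta}\|+\|\tilde\psi^{j-\theta}\|\big)\Big]$$ $$\le C'\Big[\|\nabla_h\varphi\|+t_n\|\nabla_h\psi\|+\max_{1\le k\le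 n}\big\{t_k^{\alpha/2}\big(\|f^{k-\theta}\|+\|\tilde\psi^{k-\theta}\|\big)\big\}\Big].$$ -/

import Mathlib

noncomputable section

namespace DiffusionWave

/-! ### Time meshes and the nonuniform Alikhanov formula -/

/-- `0 = t 0 < t 1 < ⋯ < t N = T`. -/
structure IsTimeMesh (T : ℝ) (N : ℕ) (t : ℕ → ℝ) : Prop where
  zero : t 0 = 0
  last : t N = T
  lt : ∀ k < N, t k < t (k + 1)

/-- The time step `τ_k = t_k - t_{k-1}` (used for `k ≥ 1`). -/
def step (t : ℕ → ℝ) (k : ℕ) : ℝ := t k - t (k - 1)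

/-- The local step-size ratio `ρ_k = τ_k / τ_{k+1}` (used for `k ≥ 1`). -/
def stepRatio (t : ℕ → ℝ) (k : ℕ) : ℝ := step t k / step t (k + 1)

/-- The offset value `g^{n-θ} = (1 - θ) g^n + θ g^{n-1}` with `θ = β / 2`, for `n ≥ 1`.
Applied to `g = t` it is the time `t_{n-θ}`. -/
def offset (β : ℝ) (g : ℕ → ℝ) (n : ℕ) : ℝ := (1 - β / 2) * g n + β / 2 * g (n - 1)

/-- The kernel `ω_μ(s) = s^{μ-1} / Γ(μ)`. -/
def omega (μ s : ℝ) : ℝ := s ^ (μ - 1) / Real.Gamma μ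

/-- The coefficient `a_{n-k}^{(n)}`, `1 ≤ k ≤ n`, indexed by `n` and `k`. -/
def aCoef (β : ℝ) (t : ℕ → ℝ) (n k : ℕ) : ℝ :=
  1 / step t k * ∫ s in t (k - 1)..min (t k) (offset β t n), omega (1 - β) (offset β t n - s)

/-- The coefficient `b_{n-k}^{(n)}`, `1 ≤ k ≤ n - 1`, indexed by `n` and `k`. -/
def bCoef (β : ℝ) (t : ℕ → ℝ) (n k : ℕ) : ℝ :=
  2 / (step t k * (step t k + step t (k + 1))) *
    ∫ s in t (k - 1)..t k, omega (1 - β) (offset β t n - s) * (s - (t (k - 1) + t k) / 2)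

/-- The Alikhanov coefficient `A_{n-k}^{(n)}`, `1 ≤ k ≤ n`, indexed by `n` and `k`. The term with
`ρ_{k-1}` is present for `k ≥ 2` only, the last one for `k ≤ n - 1` only. -/
def kernelA (β : ℝ) (t : ℕ → ℝ) (n k : ℕ) : ℝ :=
  aCoef β t n k + (if 2 ≤ k then stepRatio t (k - 1) * bCoef β t n (k - 1) else 0)
    - (if k < n then bCoef β t n k else 0)

/-- The discrete Caputo derivative `(D_τ^β g)^{n-θ} = ∑_{k=1}^n A_{n-k}^{(n)} (g^k - g^{k-1})`. -/
def discreteCaputo (β : ℝ) (t : ℕ → ℝ) (g : ℕ → ℝ) (n : ℕ) : ℝ :=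
  ∑ k ∈ Finset.Icc 1 n, kernelA β t n k * (g k - g (k - 1))

/-- The discrete complementary convolution kernel `P_{n-j}^{(n)}`, `1 ≤ j ≤ n`, indexed by `n`
and `j`: `P_0^{(n)} = 1 / A_0^{(n)}` and, for `j < n`,
`P_{n-j}^{(n)} = (1 / A_0^{(j)}) ∑_{k=j+1}^n (A_{k-j-1}^{(k)} - A_{k-j}^{(k)}) P_{n-k}^{(n)}`. -/
def kernelP (β : ℝ) (t : ℕ → ℝ) (n j : ℕ) : ℝ :=
  if n ≤ j then 1 / kernelA β t n n
  else 1 / kernelA β t j j * ∑ k ∈ (Finset.Ioc j n).attach,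
    (kernelA β t k.1 (j + 1) - kernelA β t k.1 j) * kernelP β t n k.1
termination_by n - j
decreasing_by
  have hk := Finset.mem_Ioc.mp k.2
  omega

/-! ### The equation -/

/-- The rectangle `Ω = (xl, xr) × (yl, yr)`. -/
structure Rect where
  xl : ℝ
  xr : ℝ
  yl : ℝ
  yr : ℝ
  hx : xl < xr
  hy : yl < yr

/-- The open rectangle. -/
def Rect.interior (Ω : Rect) : Set (ℝ × ℝ) := Set.Ioo Ω.xl Ω.xr ×ˢ Set.Ioo Ω.yl Ω.yr

/-- The function `g` vanishes on the boundary of the rectangle. -/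
def Rect.VanishesOnBoundary (Ω : Rect) (g : ℝ → ℝ → ℝ) : Prop :=
  ∀ x ∈ Set.Icc Ω.xl Ω.xr, ∀ y ∈ Set.Icc Ω.yl Ω.yr, (x, y) ∉ Ω.interior → g x y = 0

/-- The coefficients of the elliptic operator, as functions of `x`, `y`, `t`. -/
structure Coeffs where
  a₁ : ℝ → ℝ → ℝ → ℝ
  a₂ : ℝ → ℝ → ℝ → ℝ
  b₁ : ℝ → ℝ → ℝ → ℝ
  b₂ : ℝ → ℝ → ℝ → ℝ
  b₃ : ℝ → ℝ → ℝ → ℝ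

/-- `(𝒜 w)(x, y, t)` for `𝒜 = a₁ ∂ₓₓ + a₂ ∂ᵧᵧ + b₁ ∂ₓ + b₂ ∂ᵧ + b₃`. -/
def ellipticOp (c : Coeffs) (w : ℝ → ℝ → ℝ → ℝ) (x y t : ℝ) : ℝ :=
  c.a₁ x y t * deriv (deriv fun r => w r y t) x + c.a₂ x y t * deriv (deriv fun r => w x r t) y
    + c.b₁ x y t * deriv (fun r => w r y t) x + c.b₂ x y t * deriv (fun r => w x r t) y
    + c.b₃ x y t * w x y t

/-- The derivatives `∂ₓψ`, `∂ₓₓψ`, `∂ᵧψ`, `∂ᵧᵧψ` exist in the rectangle. -/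
def HasSecondPartials (Ω : Rect) (ψ : ℝ → ℝ → ℝ) : Prop :=
  ∀ x y, (x, y) ∈ Ω.interior →
    DifferentiableAt ℝ (fun r => ψ r y) x ∧ DifferentiableAt ℝ (deriv fun r => ψ r y) x ∧
    DifferentiableAt ℝ (fun r => ψ x r) y ∧ DifferentiableAt ℝ (deriv fun r => ψ x r) y

/-- The diffusion coefficients are positive and continuously differentiable in time on `[0, T]`,
with `|∂ₜa₁ / a₁| + |∂ₜa₂ / a₂| ≤ Cp`. -/
structure ConditionV1 (Ω : Rect) (T : ℝ) (c : Coeffs) (Cp : ℝ) : Prop where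
  pos₁ : ∀ x y, (x, y) ∈ Ω.interior → ∀ t ∈ Set.Icc 0 T, 0 < c.a₁ x y t
  pos₂ : ∀ x y, (x, y) ∈ Ω.interior → ∀ t ∈ Set.Icc 0 T, 0 < c.a₂ x y t
  smooth₁ : ∀ x y, (x, y) ∈ Ω.interior → ContDiffOn ℝ 1 (c.a₁ x y) (Set.Icc 0 T)
  smooth₂ : ∀ x y, (x, y) ∈ Ω.interior → ContDiffOn ℝ 1 (c.a₂ x y) (Set.Icc 0 T)
  bound : ∀ x y, (x, y) ∈ Ω.interior → ∀ t ∈ Set.Icc 0 T,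
    |derivWithin (c.a₁ x y) (Set.Icc 0 T) t / c.a₁ x y t|
      + |derivWithin (c.a₂ x y) (Set.Icc 0 T) t / c.a₂ x y t| ≤ Cp

/-- The weight `p = d e^{-Cp t} / (a₁ a₂)`. -/
def p (c : Coeffs) (d : ℝ → ℝ → ℝ) (Cp x y t : ℝ) : ℝ :=
  d x y * Real.exp (-Cp * t) / (c.a₁ x y t * c.a₂ x y t)

/-- `p₁ = p a₁ = d e^{-Cp t} / a₂`. -/
def p₁ (c : Coeffs) (d : ℝ → ℝ → ℝ) (Cp x y t : ℝ) : ℝ :=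
  d x y * Real.exp (-Cp * t) / c.a₂ x y t

/-- `p₂ = p a₂ = d e^{-Cp t} / a₁`. -/
def p₂ (c : Coeffs) (d : ℝ → ℝ → ℝ) (Cp x y t : ℝ) : ℝ :=
  d x y * Real.exp (-Cp * t) / c.a₁ x y t

/-- `p₃ = b₁ - p⁻¹ ∂ₓp₁`. -/
def p₃ (c : Coeffs) (d : ℝ → ℝ → ℝ) (Cp x y t : ℝ) : ℝ :=
  c.b₁ x y t - (p c d Cp x y t)⁻¹ * deriv (fun r => p₁ c d Cp r y t) x

/-- `p₄ = b₂ - p⁻¹ ∂ᵧp₂`. -/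
def p₄ (c : Coeffs) (d : ℝ → ℝ → ℝ) (Cp x y t : ℝ) : ℝ :=
  c.b₂ x y t - (p c d Cp x y t)⁻¹ * deriv (fun r => p₂ c d Cp x r t) y

/-- The function `d` is positive and continuous, the derivatives in the definitions of `p₃`, `p₄`
exist, and on `Ω × [0, T]` the functions `p`, `p₁`, `p₂` lie between `m` and `K`, while `|p₃|`,
`|p₄|`, `|b₃|` are at most `K`. -/
structure WeightBounds (Ω : Rect) (T : ℝ) (c : Coeffs) (d : ℝ → ℝ → ℝ) (Cp m K : ℝ) : Prop where
  d_pos : ∀ x y, (x, y) ∈ Ω.interior → 0 < d x y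
  d_cont : ContinuousOn (fun z : ℝ × ℝ => d z.1 z.2) Ω.interior
  diff₁ : ∀ x y, (x, y) ∈ Ω.interior → ∀ t ∈ Set.Icc 0 T,
    DifferentiableAt ℝ (fun r => p₁ c d Cp r y t) x
  diff₂ : ∀ x y, (x, y) ∈ Ω.interior → ∀ t ∈ Set.Icc 0 T,
    DifferentiableAt ℝ (fun r => p₂ c d Cp x r t) y
  bound_p : ∀ x y, (x, y) ∈ Ω.interior → ∀ t ∈ Set.Icc 0 T, p c d Cp x y t ∈ Set.Icc m K
  bound_p₁ : ∀ x y, (x, y) ∈ Ω.interior → ∀ t ∈ Set.Icc 0 T, p₁ c d Cp x y t ∈ Set.Icc m K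
  bound_p₂ : ∀ x y, (x, y) ∈ Ω.interior → ∀ t ∈ Set.Icc 0 T, p₂ c d Cp x y t ∈ Set.Icc m K
  bound_p₃ : ∀ x y, (x, y) ∈ Ω.interior → ∀ t ∈ Set.Icc 0 T, |p₃ c d Cp x y t| ≤ K
  bound_p₄ : ∀ x y, (x, y) ∈ Ω.interior → ∀ t ∈ Set.Icc 0 T, |p₄ c d Cp x y t| ≤ K
  bound_b₃ : ∀ x y, (x, y) ∈ Ω.interior → ∀ t ∈ Set.Icc 0 T, |c.b₃ x y t| ≤ K

/-! ### Space grids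

A grid function is a function of the indices `0 ≤ i ≤ Mx`, `0 ≤ j ≤ My` (values at other indices
play no role); the interior nodes are those with `1 ≤ i ≤ Mx - 1`, `1 ≤ j ≤ My - 1`. -/

/-- The mesh width in `x`. -/
def Rect.stepX (Ω : Rect) (Mx : ℕ) : ℝ := (Ω.xr - Ω.xl) / Mx

/-- The mesh width in `y`. -/
def Rect.stepY (Ω : Rect) (My : ℕ) : ℝ := (Ω.yr - Ω.yl) / My

/-- The point `xl + r hx`; the index `r` may be half-integral. -/
def Rect.nodeX (Ω : Rect) (Mx : ℕ) (r : ℝ) : ℝ := Ω.xl + r * Ω.stepX Mx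

/-- The point `yl + r hy`; the index `r` may be half-integral. -/
def Rect.nodeY (Ω : Rect) (My : ℕ) (r : ℝ) : ℝ := Ω.yl + r * Ω.stepY My

/-- The grid function with the values of `g` at the nodes. -/
def Rect.sample (Ω : Rect) (Mx My : ℕ) (g : ℝ → ℝ → ℝ) (i j : ℕ) : ℝ :=
  g (Ω.nodeX Mx i) (Ω.nodeY My j)

/-- The discrete `L²` norm `‖w‖`. -/
def norm₂ (Ω : Rect) (Mx My : ℕ) (w : ℕ → ℕ → ℝ) : ℝ :=
  Real.sqrt (Ω.stepX Mx * Ω.stepY My *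
    ∑ i ∈ Finset.Icc 1 (Mx - 1), ∑ j ∈ Finset.Icc 1 (My - 1), w i j ^ 2)

/-- The discrete seminorm `‖δₓ w‖`. -/
def normDx (Ω : Rect) (Mx My : ℕ) (w : ℕ → ℕ → ℝ) : ℝ :=
  Real.sqrt (Ω.stepX Mx * Ω.stepY My *
    ∑ i ∈ Finset.range Mx, ∑ j ∈ Finset.Icc 1 (My - 1),
      ((w (i + 1) j - w i j) / Ω.stepX Mx) ^ 2)

/-- The discrete seminorm `‖δᵧ w‖`. -/
def normDy (Ω : Rect) (Mx My : ℕ) (w : ℕ → ℕ → ℝ) : ℝ :=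
  Real.sqrt (Ω.stepX Mx * Ω.stepY My *
    ∑ i ∈ Finset.Icc 1 (Mx - 1), ∑ j ∈ Finset.range My,
      ((w i (j + 1) - w i j) / Ω.stepY My) ^ 2)

/-- The discrete `H¹` seminorm `‖∇_h w‖`. -/
def normGrad (Ω : Rect) (Mx My : ℕ) (w : ℕ → ℕ → ℝ) : ℝ :=
  Real.sqrt (normDx Ω Mx My w ^ 2 + normDy Ω Mx My w ^ 2)

/-- The discrete operator
`p⁻¹ {δₓ[p₁ δₓ] + δᵧ[p₂ δᵧ]} + p₃ δ_{x̂} + p₄ δ_{ŷ} + b₃` with coefficients taken at time `s`,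
applied to `w`, at an interior node. -/
def discreteOp (Ω : Rect) (c : Coeffs) (d : ℝ → ℝ → ℝ) (Cp : ℝ) (Mx My : ℕ) (s : ℝ)
    (w : ℕ → ℕ → ℝ) (i j : ℕ) : ℝ :=
  let hx := Ω.stepX Mx
  let hy := Ω.stepY My
  let x := Ω.nodeX Mx i
  let y := Ω.nodeY My j
  (p c d Cp x y s)⁻¹ *
      ((p₁ c d Cp (Ω.nodeX Mx (i + 1 / 2)) y s * ((w (i + 1) j - w i j) / hx)
          - p₁ c d Cp (Ω.nodeX Mx (i - 1 / 2)) y s * ((w i j - w (i - 1) j) / hx)) / hx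
        + (p₂ c d Cp x (Ω.nodeY My (j + 1 / 2)) s * ((w i (j + 1) - w i j) / hy)
          - p₂ c d Cp x (Ω.nodeY My (j - 1 / 2)) s * ((w i j - w i (j - 1)) / hy)) / hy)
    + p₃ c d Cp x y s * ((w (i + 1) j - w (i - 1) j) / (2 * hx))
    + p₄ c d Cp x y s * ((w i (j + 1) - w i (j - 1)) / (2 * hy))
    + c.b₃ x y s * w i j

/-! ### The scheme -/

/-- The grid function `f^{n-θ}`, the values of `f(·, ·, t_{n-θ})` at the nodes. -/
def source (Ω : Rect) (Mx My : ℕ) (β : ℝ) (t : ℕ → ℝ) (f : ℝ → ℝ → ℝ → ℝ) (n : ℕ) :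
    ℕ → ℕ → ℝ :=
  Ω.sample Mx My fun x y => f x y (offset β t n)

/-- The grid function `ψ̃^{n-θ}`, the values of `𝒜(tψ)` at the nodes and at time `t_{n-θ}`. -/
def sourcePsi (Ω : Rect) (Mx My : ℕ) (β : ℝ) (t : ℕ → ℝ) (c : Coeffs) (ψ : ℝ → ℝ → ℝ) (n : ℕ) :
    ℕ → ℕ → ℝ :=
  source Ω Mx My β t (ellipticOp c fun x y s => s * ψ x y) n

/-- The grid function `ũ^n = u^n - t_n ψ`. -/
def shifted (Ω : Rect) (Mx My : ℕ) (t : ℕ → ℝ) (ψ : ℝ → ℝ → ℝ) (u : ℕ → ℕ → ℕ → ℝ)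
    (n i j : ℕ) : ℝ :=
  u n i j - t n * Ω.sample Mx My ψ i j

/-- The grid functions `u^n`, `v^n`, `0 ≤ n ≤ N`, solve the scheme of order `α = 2β`:
`(D_τ^β v)^{n-θ} = 𝒜_h^{n-θ} ũ^{n-θ} + f^{n-θ} + ψ̃^{n-θ}` and `v^{n-θ} = (D_τ^β ũ)^{n-θ}` at the
interior nodes for `1 ≤ n ≤ N`, with zero boundary values, `u^0 = φ` and `v^0 = 0`. -/
structure IsSchemeSolution (Ω : Rect) (c : Coeffs) (d : ℝ → ℝ → ℝ) (Cp β : ℝ) (Mx My N : ℕ)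
    (t : ℕ → ℝ) (f : ℝ → ℝ → ℝ → ℝ) (φ ψ : ℝ → ℝ → ℝ) (u v : ℕ → ℕ → ℕ → ℝ) : Prop where
  boundary_u : ∀ n ≤ N, ∀ i ≤ Mx, ∀ j ≤ My, (i = 0 ∨ i = Mx ∨ j = 0 ∨ j = My) → u n i j = 0
  boundary_v : ∀ n ≤ N, ∀ i ≤ Mx, ∀ j ≤ My, (i = 0 ∨ i = Mx ∨ j = 0 ∨ j = My) → v n i j = 0
  initial_u : ∀ i ∈ Set.Ioo 0 Mx, ∀ j ∈ Set.Ioo 0 My, u 0 i j = Ω.sample Mx My φ i j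
  initial_v : ∀ i ∈ Set.Ioo 0 Mx, ∀ j ∈ Set.Ioo 0 My, v 0 i j = 0
  eq_v : ∀ n ∈ Set.Icc 1 N, ∀ i ∈ Set.Ioo 0 Mx, ∀ j ∈ Set.Ioo 0 My,
    discreteCaputo β t (fun k => v k i j) n
      = discreteOp Ω c d Cp Mx My (offset β t n)
          (fun i' j' => offset β (fun k => shifted Ω Mx My t ψ u k i' j') n) i j
        + source Ω Mx My β t f n i j + sourcePsi Ω Mx My β t c ψ n i j
  eq_u : ∀ n ∈ Set.Icc 1 N, ∀ i ∈ Set.Ioo 0 Mx, ∀ j ∈ Set.Ioo 0 My,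
    offset β (fun k => v k i j) n
      = discreteCaputo β t (fun k => shifted Ω Mx My t ψ u k i j) n

/-- `max_{1 ≤ k ≤ n} g k`, for `n ≥ 1`. -/
def maxUpTo (n : ℕ) (hn : 1 ≤ n) (g : ℕ → ℝ) : ℝ :=
  (Finset.Icc 1 n).sup' (Finset.nonempty_Icc.mpr hn) g

end DiffusionWave

end

open DiffusionWave

/-!
The scheme is tested with `p v^{n-θ}`. Summation by parts in space turns the elliptic part into
`p₁ δₓũ^{n-θ} · δₓv^{n-θ}` and its analogue in `y`, and since `v^{n-θ} = (D ũ)^{n-θ}`, every leading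
term has the form `c_n · w^{n-θ} · (D w)^{n-θ}` with a weight `c` decreasing in time. Such a term is
at least `½ D(c w²)` (`discreteCaputo_mul_sq_le`), so the energy
`E^k = ‖√p v^k‖² + ‖√p₁ δₓũ^k‖² + ‖√p₂ δᵧũ^k‖²` satisfies a scalar inequality
`(D E)^{n-θ} ≤ Λ X² + γ X (‖f^{n-θ}‖ + ‖ψ̃^{n-θ}‖)`, `X² = max (E^n) (E^{n-1})`, with constants
that do not see the mesh (`discreteCaputo_schemeEnergy_le_max`). The weights decrease because the
factor `e^{-C_p t}` outweighs the logarithmic derivatives of `a₁`, `a₂` (`antitoneOn_p`,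
`antitoneOn_p₁`, `antitoneOn_p₂`).

Three properties of the Alikhanov kernels are needed. With the increasing convex function
`W(s) = ω_{1-β}(t_{n-θ} - s)`, they all follow from
`W(t_{k-1}) ≤ a_k - b_k` (a weighted mean with nonnegative weight, `left_le_mean_sub_moment`) and
`a_k + ρ_{k-1} b_{k-1} ≤ W(t_k)` (comparison with the chord of `W` over the `k`-th interval,
`mean_add_moment_le_right`), where `a_k` and `b_k` belong to the `k`-th interval. These give
`W(t_{k-1}) ≤ A_{n-k}` and, for `k < n`, `A_{n-k} ≤ W(t_k)`, hence a lower bound by `ω_{1-β}` and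
monotonicity, and together with the exact value of `a_0` the gap
`(1 - θ) A_1 ≤ (1 - 2θ) A_0` between the last two kernels.

The scalar inequality is closed by a Grönwall argument without Mittag-Leffler functions
(`discrete_fractional_gronwall`). The complementary kernels satisfy
`∑ P_{n-j} (D g)^{j-θ} = g^n - g^0` and `∑ P_{n-j} t_j^{-β} ≤ Γ(1-β)`. For
`Φ_k = exp (2 t_k / δ)` one has `ω_{1-β}(δ) Φ_j / 2 ≤ (D Φ)^{j-θ}` when `t_j ≥ δ`, while the times
`t_j < δ` are absorbed by the second property; as `ω_{1-β}(δ) → ∞` for `δ → 0`, the operator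
`Λ ∑ P_{n-j}` is a contraction in the norm weighted by `Φ`. The second property also yields the
bound of the accumulated source by its maximum in a time-weighted norm.
-/

namespace DiffusionWave

/-! ### Averages of monotone and convex functions -/

theorem integral_affine (a b c₀ c₁ m : ℝ) :
    ∫ s in a..b, (c₀ + c₁ * (s - m)) = c₀ * (b - a) + c₁ * ((b - m) ^ 2 - (a - m) ^ 2) / 2 := by
  have h : ∀ s ∈ Set.uIcc a b,
      HasDerivAt (fun s => c₀ * s + c₁ * (s - m) ^ 2 / 2) (c₀ + c₁ * (s - m)) s := by
    intro s _
    have := ((hasDerivAt_id s).const_mul c₀).add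
      (((((hasDerivAt_id s).sub_const m).pow 2).const_mul c₁).div_const 2)
    refine this.congr_deriv ?_
    simp; ring
  rw [intervalIntegral.integral_eq_sub_of_hasDerivAt h
    (by apply Continuous.intervalIntegrable; fun_prop)]
  ring

theorem integral_quadratic (a b c₁ c₂ m : ℝ) :
    ∫ s in a..b, (c₁ * (s - m) + c₂ * (s - m) ^ 2)
      = c₁ * ((b - m) ^ 2 - (a - m) ^ 2) / 2 + c₂ * ((b - m) ^ 3 - (a - m) ^ 3) / 3 := by
  have h : ∀ s ∈ Set.uIcc a b,
      HasDerivAt (fun s => c₁ * (s - m) ^ 2 / 2 + c₂ * (s - m) ^ 3 / 3)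
        (c₁ * (s - m) + c₂ * (s - m) ^ 2) s := by
    intro s _
    have := (((((hasDerivAt_id s).sub_const m).pow 2).const_mul c₁).div_const 2).add
      (((((hasDerivAt_id s).sub_const m).pow 3).const_mul c₂).div_const 3)
    refine this.congr_deriv ?_
    simp; ring
  rw [intervalIntegral.integral_eq_sub_of_hasDerivAt h
    (by apply Continuous.intervalIntegrable; fun_prop)]
  ring

/-- The mean of an increasing function against the weight `1 - 2 (s - mid) / (b - a + r)`, which is
nonnegative and has mean one, is at least the value at the left end. -/
theorem left_le_mean_sub_moment {f : ℝ → ℝ} {a b r : ℝ} (hab : a < b) (hr : 0 < r)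
    (hf : ContinuousOn f (Set.Icc a b)) (hmono : MonotoneOn f (Set.Icc a b)) :
    f a ≤ 1 / (b - a) * (∫ s in a..b, f s)
      - 2 / ((b - a) * (b - a + r)) * ∫ s in a..b, f s * (s - (a + b) / 2) := by
  have hτ : 0 < b - a := sub_pos.2 hab
  have hi : IntervalIntegrable f MeasureTheory.volume a b :=
    ContinuousOn.intervalIntegrable_of_Icc hab.le hf
  have hi2 : IntervalIntegrable (fun s => f s * (s - (a + b) / 2)) MeasureTheory.volume a b :=
    ContinuousOn.intervalIntegrable_of_Icc hab.le (hf.mul (by fun_prop))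
  have hle : ∫ s in a..b, (f a + (-(2 * f a / (b - a + r))) * (s - (a + b) / 2))
      ≤ ∫ s in a..b, (f s - 2 / (b - a + r) * (f s * (s - (a + b) / 2))) := by
    refine intervalIntegral.integral_mono_on hab.le
      (by apply Continuous.intervalIntegrable; fun_prop) (hi.sub (hi2.const_mul _)) ?_
    intro s hs
    have h1 : f a ≤ f s := hmono ⟨le_rfl, hab.le⟩ hs hs.1
    have h2 : 0 ≤ 1 - 2 / (b - a + r) * (s - (a + b) / 2) := by
      rw [sub_nonneg, div_mul_eq_mul_div, div_le_one (by linarith)]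
      linarith [hs.2]
    have h3 := mul_le_mul_of_nonneg_right h1 h2
    calc _ = f a * (1 - 2 / (b - a + r) * (s - (a + b) / 2)) := by ring
      _ ≤ _ := h3
      _ = _ := by ring
  rw [integral_affine, intervalIntegral.integral_sub hi (hi2.const_mul _),
    intervalIntegral.integral_const_mul] at hle
  have h4 : f a * (b - a) ≤ (∫ s in a..b, f s)
      - 2 / (b - a + r) * ∫ s in a..b, f s * (s - (a + b) / 2) := by
    refine le_trans (le_of_eq ?_) hle
    ring
  have h5 := mul_le_mul_of_nonneg_left h4 (one_div_pos.2 hτ).le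
  have h6 : 1 / (b - a) * (f a * (b - a)) = f a := by field_simp
  rw [h6] at h5
  refine h5.trans (le_of_eq ?_)
  field_simp

theorem moment_nonneg {f : ℝ → ℝ} {a b : ℝ} (hab : a < b)
    (hf : ContinuousOn f (Set.Icc a b)) (hmono : MonotoneOn f (Set.Icc a b)) :
    0 ≤ ∫ s in a..b, f s * (s - (a + b) / 2) := by
  have hmid : (a + b) / 2 ∈ Set.Icc a b := ⟨by linarith, by linarith⟩
  have hle : ∫ s in a..b, (0 + f ((a + b) / 2) * (s - (a + b) / 2))
      ≤ ∫ s in a..b, f s * (s - (a + b) / 2) := by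
    refine intervalIntegral.integral_mono_on hab.le
      (by apply Continuous.intervalIntegrable; fun_prop)
      (ContinuousOn.intervalIntegrable_of_Icc hab.le (hf.mul (by fun_prop))) ?_
    intro s hs
    rw [zero_add]
    rcases le_total s ((a + b) / 2) with h | h
    · exact mul_le_mul_of_nonpos_right (hmono hs hmid h) (sub_nonpos.2 h)
    · exact mul_le_mul_of_nonneg_right (hmono hmid hs h) (sub_nonneg.2 h)
  rw [integral_affine] at hle
  refine le_trans (le_of_eq ?_) hle
  ring

/-- For an increasing convex function, the first moment over `[a, b]` is controlled by the gap
between the value at `c` and the mean over `[b, c]`: both are compared with the slope of the chord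
over `[b, c]`. With `r = (b - a) / (c - b)` the comparison needs `r ^ 3 ≤ 3 * (1 + r)`, which holds
for `r ≤ 7 / 4`. -/
theorem mean_add_moment_le_right {f : ℝ → ℝ} {a b c : ℝ} (hab : a < b) (hbc : b < c)
    (hratio : b - a ≤ 7 / 4 * (c - b)) (hf : ContinuousOn f (Set.Icc a c))
    (hmono : MonotoneOn f (Set.Icc a c)) (hconv : ConvexOn ℝ (Set.Icc a c) f) :
    1 / (c - b) * (∫ s in b..c, f s)
      + 2 / ((c - b) * (b - a + (c - b))) * (∫ s in a..b, f s * (s - (a + b) / 2)) ≤ f c := by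
  have hac := hab.trans hbc
  have hb : b ∈ Set.Icc a c := ⟨hab.le, hbc.le⟩
  have hc : c ∈ Set.Icc a c := ⟨hac.le, le_rfl⟩
  have hl : 0 < c - b := sub_pos.2 hbc
  have hk : 0 < b - a := sub_pos.2 hab
  obtain ⟨g, hg⟩ : ∃ g, g = (f c - f b) / (c - b) := ⟨_, rfl⟩
  have hg0 : 0 ≤ g := by
    rw [hg]; exact div_nonneg (sub_nonneg.2 (hmono hb hc hbc.le)) hl.le
  have hgm : f c - f b = g * (c - b) := by rw [hg]; field_simp
  have h1 : (∫ s in b..c, f s) ≤ ∫ s in b..c, (f c + g * (s - c)) := by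
    refine intervalIntegral.integral_mono_on hbc.le
      (ContinuousOn.intervalIntegrable_of_Icc hbc.le (hf.mono (Set.Icc_subset_Icc_left hab.le)))
      (by apply Continuous.intervalIntegrable; fun_prop) ?_
    intro s hs
    rcases eq_or_lt_of_le hs.1 with h | h
    · rw [← h]; linarith
    rcases eq_or_lt_of_le hs.2 with h' | h'
    · rw [h']; simp
    have hs' : s ∈ Set.Icc a c := ⟨hab.le.trans hs.1, hs.2⟩
    have := hconv.secant_mono_aux3 hb hc h h'
    rw [← hg, le_div_iff₀ (sub_pos.2 h')] at this
    linarith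
  obtain ⟨m, hm⟩ : ∃ m, m = (a + b) / 2 := ⟨_, rfl⟩
  have h2 : (∫ s in a..b, f s * (s - m)) ≤ ∫ s in a..b, (f m * (s - m) + g * (s - m) ^ 2) := by
    refine intervalIntegral.integral_mono_on hab.le
      (ContinuousOn.intervalIntegrable_of_Icc hab.le
        ((hf.mono (Set.Icc_subset_Icc_right hbc.le)).mul (by fun_prop)))
      (by apply Continuous.intervalIntegrable; fun_prop) ?_
    -- the slopes of `f` on `[a, b]` are at most `g`
    have key : ∀ x y, a ≤ x → x < y → y ≤ b → f y - f x ≤ g * (y - x) := by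
      intro x y hx hxy hy
      have hx' : x ∈ Set.Icc a c := ⟨hx, by linarith⟩
      have hy' : y ∈ Set.Icc a c := ⟨by linarith, by linarith⟩
      rw [← div_le_iff₀ (sub_pos.2 hxy)]
      rcases eq_or_lt_of_le hy with h | h
      · rw [hg, h]; exact hconv.slope_mono_adjacent hx' hc (h ▸ hxy) hbc
      · rw [hg]
        exact (hconv.slope_mono_adjacent hx' hb hxy h).trans
          (hconv.slope_mono_adjacent hy' hc h hbc)
    intro s hs
    rcases lt_trichotomy s m with h | h | h
    · have := key s m hs.1 h (by linarith)
      nlinarith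
    · simp [h]
    · have := key m s (by linarith) h hs.2
      nlinarith
  rw [integral_affine] at h1
  rw [integral_quadratic] at h2
  rw [← hm]
  have h1' : 1 / (c - b) * (∫ s in b..c, f s) ≤ f c - g * (c - b) / 2 := by
    have := mul_le_mul_of_nonneg_left h1 (one_div_pos.2 hl).le
    refine this.trans (le_of_eq ?_)
    field_simp; ring
  have h2' : 2 / ((c - b) * (b - a + (c - b))) * (∫ s in a..b, f s * (s - m))
      ≤ g * (c - b) / 2 := by
    have := mul_le_mul_of_nonneg_left h2
      (show 0 ≤ 2 / ((c - b) * (b - a + (c - b))) by positivity)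
    refine this.trans ?_
    rw [div_mul_eq_mul_div, div_le_iff₀ (by positivity), hm]
    have hpoly : (b - a) ^ 3 ≤ 3 * (c - b) ^ 2 * (b - a + (c - b)) := by
      have e1 : (b - a) ^ 2 ≤ (7 / 4 * (c - b)) ^ 2 := by gcongr
      nlinarith [mul_le_mul_of_nonneg_right e1 hk.le, mul_pos hl hl, mul_pos hk (mul_pos hl hl),
        mul_le_mul_of_nonneg_right hratio (mul_pos hl hl).le]
    nlinarith [mul_le_mul_of_nonneg_left hpoly hg0]
  linarith

/-! ### The Alikhanov kernels -/

theorem omega_pos {β s : ℝ} (hβ : β < 1) (hs : 0 < s) : 0 < omega (1 - β) s :=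
  div_pos (Real.rpow_pos_of_pos hs _) (Real.Gamma_pos_of_pos (by linarith))

theorem omega_antitone {β x y : ℝ} (hβ0 : 0 < β) (hβ : β < 1) (hx : 0 < x) (hxy : x ≤ y) :
    omega (1 - β) y ≤ omega (1 - β) x := by
  have := Real.Gamma_pos_of_pos (show 0 < 1 - β by linarith)
  exact div_le_div_of_nonneg_right (Real.rpow_le_rpow_of_nonpos hx hxy (by linarith)) this.le

theorem convexOn_rpow_of_nonpos {r : ℝ} (hr : r ≤ 0) :
    ConvexOn ℝ (Set.Ioi 0) fun x : ℝ => x ^ r := by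
  have hd : ∀ x : ℝ, 0 < x → HasDerivAt (fun x : ℝ => x ^ r) (r * x ^ (r - 1)) x := fun x hx =>
    Real.hasDerivAt_rpow_const (Or.inl hx.ne')
  refine MonotoneOn.convexOn_of_deriv (convex_Ioi 0)
    (fun x hx => (hd x hx).continuousAt.continuousWithinAt) ?_ ?_
  · rw [interior_Ioi]
    exact fun x hx => (hd x hx).differentiableAt.differentiableWithinAt
  · rw [interior_Ioi]
    intro x hx y hy hxy
    rw [(hd x hx).deriv, (hd y hy).deriv]
    exact mul_le_mul_of_nonpos_left (Real.rpow_le_rpow_of_nonpos hx hxy (by linarith)) hr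

theorem convexOn_omega {β T : ℝ} (hβ0 : 0 < β) (hβ : β < 1) :
    ConvexOn ℝ (Set.Iio T) fun s => omega (1 - β) (T - s) := by
  have hΓ := Real.Gamma_pos_of_pos (show 0 < 1 - β by linarith)
  have h := (convexOn_rpow_of_nonpos (r := 1 - β - 1) (by linarith)).smul (inv_pos.2 hΓ).le
  refine ⟨convex_Iio T, fun x hx y hy a b ha hb hab => ?_⟩
  have h2 := h.2 (x := T - x) (y := T - y) (Set.mem_Ioi.2 (sub_pos.2 hx))
    (Set.mem_Ioi.2 (sub_pos.2 hy)) ha hb hab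
  have e : a • (T - x) + b • (T - y) = T - (a • x + b • y) := by
    simp only [smul_eq_mul]; linear_combination T * hab
  rw [e] at h2
  simp only [smul_eq_mul, omega, div_eq_inv_mul] at h2 ⊢
  exact h2

theorem monotoneOn_omega {β T : ℝ} (hβ0 : 0 < β) (hβ : β < 1) :
    MonotoneOn (fun s => omega (1 - β) (T - s)) (Set.Iio T) := fun _ _ _ hy hxy =>
  omega_antitone hβ0 hβ (sub_pos.2 hy) (by linarith)

theorem continuousOn_omega {β T : ℝ} :
    ContinuousOn (fun s => omega (1 - β) (T - s)) (Set.Iio T) := by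
  unfold omega
  refine ContinuousOn.div_const (ContinuousOn.rpow_const (by fun_prop) ?_) _
  exact fun x hx => Or.inl (sub_pos.2 hx).ne'

section Mesh

variable {T β : ℝ} {N : ℕ} {t : ℕ → ℝ}

theorem IsTimeMesh.mono (h : IsTimeMesh T N t) {i j : ℕ} (hij : i ≤ j) (hj : j ≤ N) :
    t i ≤ t j := by
  induction j, hij using Nat.le_induction with
  | base => exact le_rfl
  | succ k _ ih => exact (ih (by omega)).trans (h.lt k (by omega)).le

theorem IsTimeMesh.strictMono (h : IsTimeMesh T N t) {i j : ℕ} (hij : i < j) (hj : j ≤ N) :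
    t i < t j :=
  (h.lt i (by omega)).trans_le (h.mono hij hj)

theorem IsTimeMesh.nonneg (h : IsTimeMesh T N t) {j : ℕ} (hj : j ≤ N) : 0 ≤ t j :=
  h.zero ▸ h.mono (Nat.zero_le j) hj

theorem IsTimeMesh.pos (h : IsTimeMesh T N t) {j : ℕ} (hj0 : 1 ≤ j) (hj : j ≤ N) : 0 < t j :=
  h.zero ▸ h.strictMono hj0 hj

theorem IsTimeMesh.le_last (h : IsTimeMesh T N t) {j : ℕ} (hj : j ≤ N) : t j ≤ T :=
  h.last ▸ h.mono hj le_rfl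

theorem IsTimeMesh.step_pos (h : IsTimeMesh T N t) {j : ℕ} (hj0 : 1 ≤ j) (hj : j ≤ N) :
    0 < step t j :=
  sub_pos.2 (h.strictMono (by omega) hj)

theorem offset_eq (β : ℝ) (g : ℕ → ℝ) (n : ℕ) :
    offset β g n = g (n - 1) + (1 - β / 2) * (g n - g (n - 1)) := by
  unfold offset; ring

theorem IsTimeMesh.lt_offset (h : IsTimeMesh T N t) (hβ : β < 1) {n : ℕ}
    (hn0 : 1 ≤ n) (hn : n ≤ N) : t (n - 1) < offset β t n := by
  rw [offset_eq]
  have := h.step_pos hn0 hn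
  unfold step at this
  nlinarith

theorem IsTimeMesh.offset_le (h : IsTimeMesh T N t) (hβ : 0 < β) {n : ℕ}
    (hn : n ≤ N) : offset β t n ≤ t n := by
  have := h.mono (Nat.sub_le n 1) hn
  unfold offset
  nlinarith

/-- The history kernel `s ↦ ω_{1-β}(t_{n-θ} - s)` whose local averages are the coefficients. -/
noncomputable def history (β : ℝ) (t : ℕ → ℝ) (n : ℕ) (s : ℝ) : ℝ :=
  omega (1 - β) (offset β t n - s)

theorem history_pos (hβ : β < 1) {n : ℕ} {s : ℝ} (hs : s < offset β t n) : 0 < history β t n s :=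
  omega_pos hβ (sub_pos.2 hs)

theorem IsTimeMesh.Icc_subset (h : IsTimeMesh T N t) (hβ : β < 1) {n k : ℕ} (hk : k < n)
    (hn : n ≤ N) (a : ℝ) : Set.Icc a (t k) ⊆ Set.Iio (offset β t n) := fun _ hs =>
  hs.2.trans_lt ((h.mono (by omega : k ≤ n - 1) (by omega)).trans_lt
    (h.lt_offset hβ (by omega) hn))

theorem aCoef_of_lt (h : IsTimeMesh T N t) (hβ : β < 1) {n k : ℕ} (hk : k < n) (hn : n ≤ N) :
    aCoef β t n k = 1 / (t k - t (k - 1)) * ∫ s in t (k - 1)..t k, history β t n s := by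
  have h1 : t k < offset β t n := h.Icc_subset hβ hk hn (t k) ⟨le_rfl, le_rfl⟩
  simp only [aCoef, min_eq_left h1.le, step, history]

/-- The current coefficient is an explicit multiple of the history kernel at the left end. -/
theorem aCoef_self (h : IsTimeMesh T N t) (hβ0 : 0 < β) (hβ : β < 1) {n : ℕ} (hn0 : 1 ≤ n)
    (hn : n ≤ N) :
    (1 - β) * aCoef β t n n = (1 - β / 2) * history β t n (t (n - 1)) := by
  have hτ := h.step_pos hn0 hn
  have hΓ := Real.Gamma_pos_of_pos (show 0 < 1 - β by linarith)
  have hσ : offset β t n - t (n - 1) = (1 - β / 2) * step t n := by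
    rw [offset_eq]; unfold step; ring
  have hσ0 : 0 < offset β t n - t (n - 1) := sub_pos.2 (h.lt_offset hβ hn0 hn)
  have hint : ∫ s in t (n - 1)..offset β t n, omega (1 - β) (offset β t n - s)
      = (offset β t n - t (n - 1)) ^ (1 - β) / (1 - β) / Real.Gamma (1 - β) := by
    rw [intervalIntegral.integral_comp_sub_left (fun x => omega (1 - β) x)]
    simp only [omega, intervalIntegral.integral_div]
    rw [integral_rpow (Or.inl (by linarith)), sub_self]
    rw [show 1 - β - 1 + 1 = 1 - β by ring, Real.zero_rpow (by linarith), sub_zero]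
  have hpow : (offset β t n - t (n - 1)) ^ (1 - β)
      = (offset β t n - t (n - 1)) ^ (1 - β - 1) * (offset β t n - t (n - 1)) := by
    conv_rhs => rw [← Real.rpow_add_one hσ0.ne']
    ring_nf
  have h1β : (1 : ℝ) - β ≠ 0 := by linarith
  simp only [aCoef, min_eq_right (h.offset_le hβ0 hn), hint, history]
  rw [hpow, omega, hσ]
  field_simp

variable (h : IsTimeMesh T N t) (hβ0 : 0 < β) (hβ : β < 1)
include h hβ0 hβ

theorem bCoef_nonneg {n k : ℕ} (hk0 : 1 ≤ k) (hk : k < n) (hn : n ≤ N) :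
    0 ≤ bCoef β t n k := by
  have hsub := h.Icc_subset hβ hk hn (t (k - 1))
  have h1 := moment_nonneg (h.strictMono (by omega : k - 1 < k) (by omega))
    (continuousOn_omega.mono hsub) ((monotoneOn_omega hβ0 hβ).mono hsub)
  have h2 := h.step_pos hk0 (by omega)
  have h3 := h.step_pos (by omega : 1 ≤ k + 1) (by omega)
  exact mul_nonneg (by positivity) h1

/-- `W(t_{k-1}) ≤ a_k - b_k` for the history kernel `W`. -/
theorem history_le_aCoef_sub_bCoef {n k : ℕ} (hk0 : 1 ≤ k) (hk : k < n) (hn : n ≤ N) :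
    history β t n (t (k - 1)) ≤ aCoef β t n k - bCoef β t n k := by
  have hsub := h.Icc_subset hβ hk hn (t (k - 1))
  have h1 := left_le_mean_sub_moment (h.strictMono (by omega : k - 1 < k) (by omega))
    (h.step_pos (by omega : 1 ≤ k + 1) (by omega))
    (continuousOn_omega.mono hsub) ((monotoneOn_omega hβ0 hβ).mono hsub)
  rw [aCoef_of_lt h hβ hk hn]
  exact h1

/-- The contribution to the kernel of the previous interval, `ρ_{k-1} b_{k-1}`. -/
theorem ratio_mul_bCoef_nonneg {n k : ℕ} (hk : k ≤ n) (hn : n ≤ N) :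
    0 ≤ (if 2 ≤ k then stepRatio t (k - 1) * bCoef β t n (k - 1) else 0) := by
  split_ifs with h2
  · refine mul_nonneg (div_nonneg (h.step_pos (by omega) (by omega)).le
      (h.step_pos (by omega) (by omega)).le) (bCoef_nonneg h hβ0 hβ (by omega) (by omega) hn)
  · exact le_rfl

/-- `a_k + ρ_{k-1} b_{k-1} ≤ W(t_k)` for the history kernel `W`; this is where the bound on the
step ratios enters. -/
theorem aCoef_add_le_history (hρ : ∀ k, 1 ≤ k → k + 1 ≤ N → stepRatio t k ≤ 7 / 4)
    {n k : ℕ} (hk0 : 1 ≤ k) (hk : k < n) (hn : n ≤ N) :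
    aCoef β t n k + (if 2 ≤ k then stepRatio t (k - 1) * bCoef β t n (k - 1) else 0)
      ≤ history β t n (t k) := by
  have hlt : t (k - 1) < t k := h.strictMono (by omega) (by omega)
  split_ifs with h2
  · obtain ⟨j, rfl⟩ : ∃ j, k = j + 2 := ⟨k - 2, by omega⟩
    have hs1 := h.step_pos (by omega : 1 ≤ j + 1) (by omega)
    have hs2 := h.step_pos (by omega : 1 ≤ j + 2) (by omega)
    have hr := hρ (j + 1) (by omega) (by omega)
    rw [stepRatio, div_le_iff₀ hs2] at hr
    have hsub := h.Icc_subset hβ hk hn (t j)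
    have h1 := mean_add_moment_le_right (h.strictMono (by omega : j < j + 1) (by omega))
      (h.strictMono (by omega : j + 1 < j + 2) (by omega)) hr
      (continuousOn_omega.mono hsub) ((monotoneOn_omega hβ0 hβ).mono hsub)
      ((convexOn_omega hβ0 hβ).subset hsub (convex_Icc _ _))
    rw [aCoef_of_lt h hβ hk hn]
    refine le_trans (le_of_eq ?_) h1
    simp only [stepRatio, bCoef, history, step, Nat.add_sub_cancel,
      show j + 2 - 1 = j + 1 from rfl, show j + 1 + 1 = j + 2 from rfl] at hs1 hs2 ⊢
    field_simp
  · have hsub := h.Icc_subset hβ hk hn (t (k - 1))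
    -- the mean of an increasing function is at most its right end value
    have h1 : ∫ s in t (k - 1)..t k, history β t n s
        ≤ ∫ s in t (k - 1)..t k, history β t n (t k) := by
      refine intervalIntegral.integral_mono_on hlt.le
        (ContinuousOn.intervalIntegrable_of_Icc hlt.le (continuousOn_omega.mono hsub)) (by simp) ?_
      intro s hs
      exact monotoneOn_omega hβ0 hβ (hsub hs) (hsub ⟨hlt.le, le_rfl⟩) hs.2
    rw [intervalIntegral.integral_const, smul_eq_mul] at h1
    rw [aCoef_of_lt h hβ hk hn, add_zero, one_div, inv_mul_le_iff₀ (sub_pos.2 hlt)]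
    exact h1

theorem aCoef_self_nonneg {n : ℕ} (hn0 : 1 ≤ n) (hn : n ≤ N) : 0 ≤ aCoef β t n n := by
  have h1 := aCoef_self h hβ0 hβ hn0 hn
  have h2 := history_pos hβ (h.lt_offset hβ hn0 hn)
  have h3 : 0 < (1 - β / 2) * history β t n (t (n - 1)) := mul_pos (by linarith) h2
  rw [← h1] at h3
  exact (pos_of_mul_pos_right h3 (by linarith)).le

theorem history_le_kernelA {n k : ℕ} (hk0 : 1 ≤ k) (hk : k ≤ n) (hn : n ≤ N) :
    history β t n (t (k - 1)) ≤ kernelA β t n k := by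
  have h1 := ratio_mul_bCoef_nonneg h hβ0 hβ hk hn
  unfold kernelA
  rcases eq_or_lt_of_le hk with rfl | hlt
  · have h2 := aCoef_self h hβ0 hβ hk0 hn
    have h3 := aCoef_self_nonneg h hβ0 hβ hk0 hn
    have h4 := history_pos hβ (h.lt_offset hβ hk0 hn)
    simp only [lt_irrefl, if_false]
    nlinarith
  · have := history_le_aCoef_sub_bCoef h hβ0 hβ hk0 hlt hn
    rw [if_pos hlt]
    linarith

/-- The kernels dominate the continuous kernel `ω_{1-β}`. -/
theorem omega_le_kernelA {n k : ℕ} (hk0 : 1 ≤ k) (hk : k ≤ n) (hn : n ≤ N) :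
    omega (1 - β) (t n - t (k - 1)) ≤ kernelA β t n k := by
  refine le_trans ?_ (history_le_kernelA h hβ0 hβ hk0 hk hn)
  have h1 := h.mono (by omega : k - 1 ≤ n - 1) (by omega)
  exact omega_antitone hβ0 hβ (by linarith [h.lt_offset hβ (by omega : 1 ≤ n) hn])
    (by linarith [h.offset_le hβ0 hn])

theorem kernelA_pos {n k : ℕ} (hk0 : 1 ≤ k) (hk : k ≤ n) (hn : n ≤ N) : 0 < kernelA β t n k :=
  (omega_pos hβ (sub_pos.2 (h.strictMono (by omega) hn))).trans_le
    (omega_le_kernelA h hβ0 hβ hk0 hk hn)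

theorem kernelA_le_history (hρ : ∀ k, 1 ≤ k → k + 1 ≤ N → stepRatio t k ≤ 7 / 4)
    {n k : ℕ} (hk0 : 1 ≤ k) (hk : k < n) (hn : n ≤ N) :
    kernelA β t n k ≤ history β t n (t k) := by
  have h1 := aCoef_add_le_history h hβ0 hβ hρ hk0 hk hn
  have h2 := bCoef_nonneg h hβ0 hβ hk0 hk hn
  unfold kernelA
  rw [if_pos hk]
  linarith

theorem kernelA_le_succ (hρ : ∀ k, 1 ≤ k → k + 1 ≤ N → stepRatio t k ≤ 7 / 4)
    {n k : ℕ} (hk0 : 1 ≤ k) (hk : k < n) (hn : n ≤ N) :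
    kernelA β t n k ≤ kernelA β t n (k + 1) :=
  (kernelA_le_history h hβ0 hβ hρ hk0 hk hn).trans
    (history_le_kernelA h hβ0 hβ (by omega : 1 ≤ k + 1) (by omega) hn)

/-- The gap between the two most recent kernels, which makes the value at `t_{n-θ}` admissible as a
multiplier. -/
theorem kernelA_gap (hρ : ∀ k, 1 ≤ k → k + 1 ≤ N → stepRatio t k ≤ 7 / 4)
    {n : ℕ} (hn2 : 2 ≤ n) (hn : n ≤ N) :
    (1 - β / 2) * kernelA β t n (n - 1) ≤ (1 - β) * kernelA β t n n := by
  have h1 := kernelA_le_history h hβ0 hβ hρ (by omega : 1 ≤ n - 1) (by omega) hn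
  have h2 := aCoef_self h hβ0 hβ (by omega : 1 ≤ n) hn
  have h3 := ratio_mul_bCoef_nonneg h hβ0 hβ (le_refl n) hn
  have h4 : aCoef β t n n ≤ kernelA β t n n := by
    unfold kernelA
    rw [if_neg (lt_irrefl n)]
    linarith
  calc _ ≤ (1 - β / 2) * history β t n (t (n - 1)) :=
        mul_le_mul_of_nonneg_left h1 (by linarith)
    _ = (1 - β) * aCoef β t n n := h2.symm
    _ ≤ _ := mul_le_mul_of_nonneg_left h4 (by linarith)

end Mesh

/-! ### The complementary kernels -/

theorem sum_Icc_sub_pred (g : ℕ → ℝ) (n : ℕ) :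
    ∑ k ∈ Finset.Icc 1 n, (g k - g (k - 1)) = g n - g 0 := by
  induction n with
  | zero => simp
  | succ n ih => rw [Finset.sum_Icc_succ_top (by omega), ih]; simp

theorem kernelP_self (β : ℝ) (t : ℕ → ℝ) (n : ℕ) : kernelP β t n n = 1 / kernelA β t n n := by
  rw [kernelP, if_pos le_rfl]

theorem kernelP_of_lt (β : ℝ) (t : ℕ → ℝ) {n j : ℕ} (hj : j < n) :
    kernelP β t n j = 1 / kernelA β t j j * ∑ k ∈ Finset.Ioc j n,
      (kernelA β t k (j + 1) - kernelA β t k j) * kernelP β t n k := by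
  rw [kernelP, if_neg (by omega)]
  congr 1
  exact Finset.sum_attach (Finset.Ioc j n)
    (fun k => (kernelA β t k (j + 1) - kernelA β t k j) * kernelP β t n k)

section Mesh

variable {T β : ℝ} {N : ℕ} {t : ℕ → ℝ} (h : IsTimeMesh T N t) (hβ0 : 0 < β) (hβ : β < 1)
include h hβ0 hβ

/-- The complementary kernels are the left inverse of the summed kernels:
`∑ⱼ P_{n-j} A_{j-k} = 1`. -/
theorem sum_kernelP_mul_kernelA {n k : ℕ} (hk0 : 1 ≤ k) (hk : k ≤ n) (hn : n ≤ N) :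
    ∑ j ∈ Finset.Icc k n, kernelP β t n j * kernelA β t j k = 1 := by
  obtain ⟨d, rfl⟩ := Nat.exists_eq_add_of_le hk
  induction d generalizing k with
  | zero =>
    have := kernelA_pos h hβ0 hβ hk0 le_rfl hn
    simp only [add_zero, Finset.Icc_self, Finset.sum_singleton, kernelP_self]
    field_simp
  | succ d ih =>
    have hA := kernelA_pos h hβ0 hβ hk0 le_rfl (by omega)
    have ih' := ih (k := k + 1) (by omega) (by omega) (by omega)
    rw [show k + 1 + d = k + (d + 1) by ring] at ih'
    rw [← Finset.sum_Ioc_add_eq_sum_Icc (by omega), kernelP_of_lt β t (by omega : k < k + (d + 1)),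
      mul_comm (1 / kernelA β t k k), mul_assoc, one_div_mul_cancel hA.ne', mul_one,
      ← Finset.sum_add_distrib]
    rw [show Finset.Icc (k + 1) (k + (d + 1)) = Finset.Ioc k (k + (d + 1)) by ext; simp]
      at ih'
    rw [← ih']
    exact Finset.sum_congr rfl fun j _ => by ring

/-- Summation against the complementary kernels inverts the discrete Caputo derivative. -/
theorem sum_kernelP_mul_discreteCaputo (g : ℕ → ℝ) {n : ℕ} (hn : n ≤ N) :
    ∑ j ∈ Finset.Icc 1 n, kernelP β t n j * discreteCaputo β t g j = g n - g 0 := by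
  rw [← sum_Icc_sub_pred g n]
  simp only [discreteCaputo, Finset.mul_sum]
  rw [Finset.sum_comm' (t' := Finset.Icc 1 n) (s' := fun k => Finset.Icc k n)
    (by intro x y; simp only [Finset.mem_Icc]; omega)]
  refine Finset.sum_congr rfl fun k hk => ?_
  rw [Finset.mem_Icc] at hk
  simp only [← mul_assoc]
  rw [← Finset.sum_mul, sum_kernelP_mul_kernelA h hβ0 hβ hk.1 hk.2 hn, one_mul]

variable (hρ : ∀ k, 1 ≤ k → k + 1 ≤ N → stepRatio t k ≤ 7 / 4)
include hρ

theorem kernelP_nonneg {n j : ℕ} (hj0 : 1 ≤ j) (hj : j ≤ n) (hn : n ≤ N) :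
    0 ≤ kernelP β t n j := by
  obtain ⟨d, hd⟩ : ∃ d, d = n - j := ⟨_, rfl⟩
  induction d using Nat.strong_induction_on generalizing j with
  | _ d ih =>
    have hA := kernelA_pos h hβ0 hβ hj0 le_rfl (by omega)
    rcases eq_or_lt_of_le hj with rfl | hlt
    · rw [kernelP_self]; positivity
    · rw [kernelP_of_lt β t hlt]
      refine mul_nonneg (by positivity) (Finset.sum_nonneg fun k hk => ?_)
      rw [Finset.mem_Ioc] at hk
      exact mul_nonneg (sub_nonneg.2 (kernelA_le_succ h hβ0 hβ hρ hj0 hk.1 (by omega)))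
        (ih (n - k) (by omega) (by omega) hk.2 rfl)

/-- `∑ⱼ P_{n-j} ω_{1-β}(t_j) ≤ 1`, in terms of powers of `t_j`. -/
theorem sum_kernelP_mul_rpow_le {n : ℕ} (hn0 : 1 ≤ n) (hn : n ≤ N) :
    ∑ j ∈ Finset.Icc 1 n, kernelP β t n j * t j ^ (-β) ≤ Real.Gamma (1 - β) := by
  have hΓ := Real.Gamma_pos_of_pos (show 0 < 1 - β by linarith)
  have h0 := congrArg (Real.Gamma (1 - β) * ·) (sum_kernelP_mul_kernelA h hβ0 hβ le_rfl hn0 hn)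
  simp only [mul_one, Finset.mul_sum] at h0
  refine le_trans ?_ h0.le
  refine Finset.sum_le_sum fun j hj => ?_
  rw [Finset.mem_Icc] at hj
  have h1 := omega_le_kernelA h hβ0 hβ le_rfl hj.1 (by omega)
  rw [Nat.sub_self, h.zero, sub_zero, omega, div_le_iff₀ hΓ,
    show 1 - β - 1 = -β by ring] at h1
  have := mul_le_mul_of_nonneg_left h1 (kernelP_nonneg h hβ0 hβ hρ hj.1 hj.2 hn)
  linarith

end Mesh

/-! ### Energy inequalities for the discrete Caputo derivative -/

/-- With `x_k = w_k - w_{k-1}` and the partial sums `S_l = ∑_{k ≤ l} a_k x_k`, the quantity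
`2 w_l S_l - ∑_{k ≤ l} a_k (w_k² - w_{k-1}²)` equals a sum of multiples of the squares `S_k²`; for
an increasing positive kernel it is at least `S_l² / a_l`. -/
theorem sq_sum_div_le_of_monotone_kernel {a w : ℕ → ℝ} {l : ℕ} (hl : 1 ≤ l)
    (ha : ∀ k, 1 ≤ k → k ≤ l → 0 < a k) (hmono : ∀ k, 1 ≤ k → k < l → a k ≤ a (k + 1)) :
    (∑ k ∈ Finset.Icc 1 l, a k * (w k - w (k - 1))) ^ 2 / a l
      ≤ 2 * w l * (∑ k ∈ Finset.Icc 1 l, a k * (w k - w (k - 1)))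
        - ∑ k ∈ Finset.Icc 1 l, a k * (w k ^ 2 - w (k - 1) ^ 2) := by
  induction l, hl using Nat.le_induction with
  | base =>
    have := ha 1 le_rfl le_rfl
    simp
    rw [div_le_iff₀ this]
    apply le_of_eq; ring
  | succ l hl ih =>
    have ih := ih (fun k h1 h2 => ha k h1 (by omega)) (fun k h1 h2 => hmono k h1 (by omega))
    rw [Finset.sum_Icc_succ_top (by omega), Finset.sum_Icc_succ_top (by omega)]
    simp only [Nat.add_sub_cancel]
    set S := ∑ k ∈ Finset.Icc 1 l, a k * (w k - w (k - 1))
    set R := ∑ k ∈ Finset.Icc 1 l, a k * (w k ^ 2 - w (k - 1) ^ 2)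
    have h1 := ha l hl (by omega)
    have h2 := ha (l + 1) (by omega) le_rfl
    have h3 : S ^ 2 / a (l + 1) ≤ S ^ 2 / a l :=
      div_le_div_of_nonneg_left (sq_nonneg S) h1 (hmono l hl (by omega))
    have h4 : (S + a (l + 1) * (w (l + 1) - w l)) ^ 2 / a (l + 1)
        = S ^ 2 / a (l + 1) + 2 * S * (w (l + 1) - w l) + a (l + 1) * (w (l + 1) - w l) ^ 2 := by
      field_simp; ring
    rw [h4]
    nlinarith

section Mesh

variable {T β : ℝ} {N : ℕ} {t : ℕ → ℝ} (h : IsTimeMesh T N t) (hβ0 : 0 < β) (hβ : β < 1)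
include h hβ0 hβ

variable (hρ : ∀ k, 1 ≤ k → k + 1 ≤ N → stepRatio t k ≤ 7 / 4)
include hρ

theorem discreteCaputo_sq_le (w : ℕ → ℝ) {n : ℕ} (hn0 : 1 ≤ n) (hn : n ≤ N) :
    discreteCaputo β t (fun k => w k ^ 2) n ≤ 2 * (offset β w n * discreteCaputo β t w n) := by
  unfold discreteCaputo
  have hA : ∀ k, 1 ≤ k → k ≤ n → 0 < kernelA β t n k := fun k h1 h2 =>
    kernelA_pos h hβ0 hβ h1 h2 hn
  obtain ⟨l, rfl⟩ : ∃ l, n = l + 1 := ⟨n - 1, by omega⟩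
  rw [offset_eq, Finset.sum_Icc_succ_top (by omega), Finset.sum_Icc_succ_top (by omega)]
  simp only [Nat.add_sub_cancel]
  have h2 := hA (l + 1) (by omega) le_rfl
  set S := ∑ k ∈ Finset.Icc 1 l, kernelA β t (l + 1) k * (w k - w (k - 1)) with hS
  set R := ∑ k ∈ Finset.Icc 1 l, kernelA β t (l + 1) k * (w k ^ 2 - w (k - 1) ^ 2) with hR
  set a := kernelA β t (l + 1) (l + 1)
  set x := w (l + 1) - w l with hx
  have hw : w (l + 1) = w l + x := by rw [hx]; ring
  rw [hw]
  rcases Nat.eq_zero_or_pos l with rfl | hl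
  · have e1 : S = 0 := by simp [hS]
    have e2 : R = 0 := by simp [hR]
    rw [e1, e2]
    nlinarith [mul_nonneg h2.le (sq_nonneg x), mul_nonneg (mul_nonneg h2.le (sq_nonneg x))
      (sub_nonneg.2 hβ.le)]
  · have h3 := sq_sum_div_le_of_monotone_kernel (w := w) hl (fun k h1 h2 => hA k h1 (by omega))
      (fun k h1 h2 => kernelA_le_succ h hβ0 hβ hρ h1 (by omega) hn)
    rw [← hS, ← hR] at h3
    have h1 := hA l hl (by omega)
    have hgap := kernelA_gap h hβ0 hβ hρ (by omega : 2 ≤ l + 1) hn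
    simp only [Nat.add_sub_cancel] at hgap
    set b := kernelA β t (l + 1) l
    -- the gap condition bounds the form in `S` and `a x` below by a square
    have key : 0 ≤ S ^ 2 / b + 2 * (1 - β / 2) * x * S + (1 - β) * a * x ^ 2 := by
      have e : S ^ 2 / b + 2 * (1 - β / 2) * x * S + (1 - β) * a * x ^ 2
          = (S + (1 - β / 2) * b * x) ^ 2 / b + ((1 - β) * a - (1 - β / 2) ^ 2 * b) * x ^ 2 := by
        field_simp; ring
      rw [e]
      have : (1 - β / 2) ^ 2 * b ≤ (1 - β) * a := by
        refine le_trans ?_ hgap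
        nlinarith [mul_nonneg (show 0 ≤ (1 - β / 2) * (β / 2) by nlinarith) h1.le]
      have := mul_nonneg (sub_nonneg.2 this) (sq_nonneg x)
      positivity
    nlinarith

/-- A weight decreasing in time may be moved inside the discrete Caputo derivative of a nonnegative
sequence, at the cost of an inequality. -/
theorem discreteCaputo_mul_le {c y : ℕ → ℝ} {n : ℕ} (hn0 : 1 ≤ n) (hn : n ≤ N)
    (hc : ∀ k ≤ n, c n ≤ c k) (hy : ∀ k, 0 ≤ y k) :
    discreteCaputo β t (fun k => c k * y k) n ≤ c n * discreteCaputo β t y n := by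
  have key : ∀ l, 1 ≤ l → l ≤ n →
      ∑ k ∈ Finset.Icc 1 l, kernelA β t n k * ((c k - c n) * y k - (c (k - 1) - c n) * y (k - 1))
        ≤ kernelA β t n l * ((c l - c n) * y l) := by
    have hz : ∀ k ≤ n, 0 ≤ (c k - c n) * y k := fun k hk =>
      mul_nonneg (sub_nonneg.2 (hc k hk)) (hy k)
    intro l hl
    induction l, hl using Nat.le_induction with
    | base =>
      intro _
      have := mul_nonneg (kernelA_pos h hβ0 hβ le_rfl hn0 hn).le (hz 0 (by omega))
      simp only [Finset.Icc_self, Finset.sum_singleton, Nat.sub_self]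
      linarith
    | succ l hl ih =>
      intro hl'
      rw [Finset.sum_Icc_succ_top (by omega), Nat.add_sub_cancel]
      have h1 := ih (by omega)
      have h2 := mul_le_mul_of_nonneg_right
        (kernelA_le_succ h hβ0 hβ hρ hl (by omega) hn) (hz l (by omega))
      linarith
  have h1 := key n hn0 le_rfl
  rw [sub_self, zero_mul, mul_zero] at h1
  unfold discreteCaputo
  rw [Finset.mul_sum, ← sub_nonpos, ← Finset.sum_sub_distrib]
  refine le_trans (le_of_eq (Finset.sum_congr rfl fun k _ => ?_)) h1
  ring

theorem discreteCaputo_mul_sq_le {c w : ℕ → ℝ} {n : ℕ} (hn0 : 1 ≤ n) (hn : n ≤ N)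
    (hc0 : 0 ≤ c n) (hc : ∀ k ≤ n, c n ≤ c k) :
    discreteCaputo β t (fun k => c k * w k ^ 2) n
      ≤ 2 * (c n * (offset β w n * discreteCaputo β t w n)) := by
  have h1 := discreteCaputo_mul_le h hβ0 hβ hρ hn0 hn hc (fun k => sq_nonneg (w k))
  have h2 := mul_le_mul_of_nonneg_left (discreteCaputo_sq_le h hβ0 hβ hρ w hn0 hn) hc0
  linarith

end Mesh

/-! ### A discrete fractional Grönwall inequality -/

section Mesh

variable {T β : ℝ} {N : ℕ} {t : ℕ → ℝ} (h : IsTimeMesh T N t) (hβ0 : 0 < β) (hβ : β < 1)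
include h hβ0 hβ

/-- The exponential `Φ_k = exp (2 t_k / δ)` is a supersolution: where `t_j ≥ δ` its discrete Caputo
derivative dominates `ω_{1-β}(δ) Φ_j / 2`, and the remaining times are absorbed by the second
term. -/
theorem exp_supersolution {δ : ℝ} (hδ : 0 < δ) (hτ : ∀ k ∈ Set.Icc 1 N, step t k ≤ δ / 2)
    {j n : ℕ} (hj0 : 1 ≤ j) (hj : j ≤ n) (hn : n ≤ N) :
    omega (1 - β) δ / 2 * Real.exp (2 / δ * t j)
      ≤ discreteCaputo β t (fun k => Real.exp (2 / δ * t k)) j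
        + Real.exp (2 / δ * t n) / Real.Gamma (1 - β) / 2 * t j ^ (-β) := by
  have hω := omega_pos hβ hδ
  have hΓ := Real.Gamma_pos_of_pos (show 0 < 1 - β by linarith)
  have hκ : 0 < 2 / δ := by positivity
  have htj := h.pos hj0 (hj.trans hn)
  have hmonoE : ∀ {x y : ℝ}, x ≤ y → Real.exp (2 / δ * x) ≤ Real.exp (2 / δ * y) := fun hxy =>
    Real.exp_le_exp.2 (mul_le_mul_of_nonneg_left hxy hκ.le)
  have hterm : ∀ k ∈ Finset.Icc 1 j, 0 ≤ kernelA β t j k *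
      (Real.exp (2 / δ * t k) - Real.exp (2 / δ * t (k - 1))) := fun k hk => by
    rw [Finset.mem_Icc] at hk
    exact mul_nonneg (kernelA_pos h hβ0 hβ hk.1 hk.2 (by omega)).le
      (sub_nonneg.2 (hmonoE (h.mono (by omega) (by omega))))
  rcases le_or_gt δ (t j) with hle | hlt
  · -- only the last part of the history, of length `δ / 2`, is used
    -- and the exponential is cut off below its value at `t_j - δ / 2`
    obtain ⟨F, hF⟩ : ∃ F : ℕ → ℝ,
      F = fun k => max (Real.exp (2 / δ * t k)) (Real.exp (2 / δ * (t j - δ / 2))) := ⟨_, rfl⟩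
    have h1 : omega (1 - β) δ * (F j - F 0)
        ≤ discreteCaputo β t (fun k => Real.exp (2 / δ * t k)) j := by
      rw [← sum_Icc_sub_pred F j, Finset.mul_sum]
      refine Finset.sum_le_sum fun k hk => ?_
      have hk' := hk
      rw [Finset.mem_Icc] at hk
      have hstep := hτ k ⟨hk.1, by omega⟩
      unfold step at hstep
      have hm : t (k - 1) ≤ t k := h.mono (by omega) (by omega)
      rcases le_or_gt (t j - δ) (t (k - 1)) with hge | hlt
      · have e1 : omega (1 - β) δ ≤ kernelA β t j k :=
          (omega_antitone hβ0 hβ (sub_pos.2 (h.strictMono (by omega) (by omega)))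
            (by linarith)).trans (omega_le_kernelA h hβ0 hβ hk.1 hk.2 (by omega))
        have e2 : F k - F (k - 1)
            ≤ Real.exp (2 / δ * t k) - Real.exp (2 / δ * t (k - 1)) := by
          have := hmonoE hm
          simp only [hF]
          rcases le_total (Real.exp (2 / δ * t k)) (Real.exp (2 / δ * (t j - δ / 2))) with g | g
          · rw [max_eq_right g, max_eq_right (this.trans g)]; linarith
          · rw [max_eq_left g]
            linarith [le_max_left (Real.exp (2 / δ * t (k - 1)))
              (Real.exp (2 / δ * (t j - δ / 2)))]
        have e3 : 0 ≤ Real.exp (2 / δ * t k) - Real.exp (2 / δ * t (k - 1)) :=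
          sub_nonneg.2 (hmonoE hm)
        exact (mul_le_mul_of_nonneg_left e2 hω.le).trans (mul_le_mul_of_nonneg_right e1 e3)
      · have e1 : F k = F (k - 1) := by
          simp only [hF]
          rw [max_eq_right (hmonoE (by linarith)), max_eq_right (hmonoE (by linarith))]
        rw [e1, sub_self, mul_zero]
        exact hterm k hk'
    have h2 : F 0 ≤ Real.exp (2 / δ * t j) / 2 := by
      have e1 : F 0 = Real.exp (2 / δ * (t j - δ / 2)) := by
        simp only [hF]
        exact max_eq_right (hmonoE (by rw [h.zero]; linarith))
      have e2 : 2 / δ * (t j - δ / 2) = 2 / δ * t j - 1 := by field_simp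
      rw [e1, e2, Real.exp_sub]
      refine div_le_div_of_nonneg_left (Real.exp_pos _).le two_pos ?_
      linarith [Real.add_one_le_exp 1]
    have h3 : F j = Real.exp (2 / δ * t j) := by
      simp only [hF]
      exact max_eq_left (hmonoE (by linarith))
    have h4 : 0 ≤ Real.exp (2 / δ * t n) / Real.Gamma (1 - β) / 2 * t j ^ (-β) := by positivity
    rw [h3] at h1
    nlinarith
  · have h1 : 0 ≤ discreteCaputo β t (fun k => Real.exp (2 / δ * t k)) j :=
      Finset.sum_nonneg hterm
    have h2 : omega (1 - β) δ ≤ t j ^ (-β) / Real.Gamma (1 - β) := by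
      refine (omega_antitone hβ0 hβ htj hlt.le).trans (le_of_eq ?_)
      rw [omega, show 1 - β - 1 = -β by ring]
    have h3 : Real.exp (2 / δ * t j) ≤ Real.exp (2 / δ * t n) := hmonoE (h.mono hj hn)
    have h4 : omega (1 - β) δ / 2 * Real.exp (2 / δ * t j)
        ≤ t j ^ (-β) / Real.Gamma (1 - β) / 2 * Real.exp (2 / δ * t n) := by
      gcongr
    have h5 : t j ^ (-β) / Real.Gamma (1 - β) / 2 * Real.exp (2 / δ * t n)
        = Real.exp (2 / δ * t n) / Real.Gamma (1 - β) / 2 * t j ^ (-β) := by ring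
    linarith

variable (hρ : ∀ k, 1 ≤ k → k + 1 ≤ N → stepRatio t k ≤ 7 / 4)
include hρ

theorem sum_kernelP_mul_exp_le {δ : ℝ} (hδ : 0 < δ) (hτ : ∀ k ∈ Set.Icc 1 N, step t k ≤ δ / 2)
    {n : ℕ} (hn : n ≤ N) :
    omega (1 - β) δ * ∑ j ∈ Finset.Icc 1 n, kernelP β t n j * Real.exp (2 / δ * t j)
      ≤ 3 * Real.exp (2 / δ * t n) := by
  rcases Nat.eq_zero_or_pos n with rfl | hn0
  · simp only [Finset.Icc_eq_empty (by omega : ¬ 1 ≤ 0), Finset.sum_empty, mul_zero]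
    positivity
  have hΓ := Real.Gamma_pos_of_pos (show 0 < 1 - β by linarith)
  have h1 : ∑ j ∈ Finset.Icc 1 n, kernelP β t n j *
        (omega (1 - β) δ / 2 * Real.exp (2 / δ * t j))
      ≤ ∑ j ∈ Finset.Icc 1 n, kernelP β t n j *
        (discreteCaputo β t (fun k => Real.exp (2 / δ * t k)) j
          + Real.exp (2 / δ * t n) / Real.Gamma (1 - β) / 2 * t j ^ (-β)) := by
    refine Finset.sum_le_sum fun j hj => ?_
    rw [Finset.mem_Icc] at hj
    exact mul_le_mul_of_nonneg_left (exp_supersolution h hβ0 hβ hδ hτ hj.1 hj.2 hn)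
      (kernelP_nonneg h hβ0 hβ hρ hj.1 hj.2 hn)
  simp only [mul_add, Finset.sum_add_distrib] at h1
  rw [sum_kernelP_mul_discreteCaputo h hβ0 hβ _ hn] at h1
  have h2 := mul_le_mul_of_nonneg_left (sum_kernelP_mul_rpow_le h hβ0 hβ hρ hn0 hn)
    (show 0 ≤ Real.exp (2 / δ * t n) / Real.Gamma (1 - β) / 2 by positivity)
  have h3 : Real.exp (2 / δ * t n) / Real.Gamma (1 - β) / 2 * Real.Gamma (1 - β)
      = Real.exp (2 / δ * t n) / 2 := by field_simp
  have h4 : ∑ j ∈ Finset.Icc 1 n, kernelP β t n j *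
        (omega (1 - β) δ / 2 * Real.exp (2 / δ * t j))
      = omega (1 - β) δ / 2 * ∑ j ∈ Finset.Icc 1 n, kernelP β t n j * Real.exp (2 / δ * t j) := by
    rw [Finset.mul_sum]
    exact Finset.sum_congr rfl fun j _ => by ring
  have h5 : ∑ j ∈ Finset.Icc 1 n, kernelP β t n j *
        (Real.exp (2 / δ * t n) / Real.Gamma (1 - β) / 2 * t j ^ (-β))
      = Real.exp (2 / δ * t n) / Real.Gamma (1 - β) / 2 *
        ∑ j ∈ Finset.Icc 1 n, kernelP β t n j * t j ^ (-β) := by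
    rw [Finset.mul_sum]
    exact Finset.sum_congr rfl fun j _ => by ring
  rw [h4, h5] at h1
  linarith [Real.exp_pos (2 / δ * t 0)]

/-- The Grönwall inequality for running maxima `M`, with `δ` so small that `6 Λ ≤ ω_{1-β}(δ)`: the
largest ratio `M_l / exp (2 t_l / δ)` is bounded. -/
theorem le_of_le_add_sum_kernelP {δ Λ H : ℝ} (hδ : 0 < δ)
    (hτ : ∀ k ∈ Set.Icc 1 N, step t k ≤ δ / 2) (hΛ0 : 0 ≤ Λ) (hΛ : 6 * Λ ≤ omega (1 - β) δ)
    {M : ℕ → ℝ} {n : ℕ} (hn : n ≤ N)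
    (hM : ∀ l ≤ n, ∃ l' ≤ l, M l ≤ H + Λ * ∑ j ∈ Finset.Icc 1 l', kernelP β t l' j * M j)
    (hM0 : ∀ l, 0 ≤ M l) :
    M n ≤ 2 * Real.exp (2 / δ * T) * H := by
  obtain ⟨Φ, hΦ⟩ : ∃ Φ : ℕ → ℝ, Φ = fun k => Real.exp (2 / δ * t k) := ⟨_, rfl⟩
  have hΦ0 : ∀ k, 0 < Φ k := fun k => by rw [hΦ]; exact Real.exp_pos _
  have hΦm : ∀ {k l}, k ≤ l → l ≤ N → Φ k ≤ Φ l := fun hkl hl => by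
    rw [hΦ]
    exact Real.exp_le_exp.2 (mul_le_mul_of_nonneg_left (h.mono hkl hl) (by positivity))
  obtain ⟨l, hl, hmax⟩ := Finset.exists_max_image (Finset.range (n + 1)) (fun k => M k / Φ k)
    ⟨0, by simp⟩
  obtain ⟨μ, hμ⟩ : ∃ μ, μ = M l / Φ l := ⟨_, rfl⟩
  have hμ0 : 0 ≤ μ := hμ ▸ div_nonneg (hM0 l) (hΦ0 l).le
  have hle : ∀ j ≤ n, M j ≤ μ * Φ j := fun j hj => by
    rw [← div_le_iff₀ (hΦ0 j), hμ]
    exact hmax j (Finset.mem_range.2 (by omega))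
  have hl' : l ≤ n := by rw [Finset.mem_range] at hl; omega
  obtain ⟨l', hl'l, hineq⟩ := hM l hl'
  have h1 : ∑ j ∈ Finset.Icc 1 l', kernelP β t l' j * M j
      ≤ μ * ∑ j ∈ Finset.Icc 1 l', kernelP β t l' j * Φ j := by
    rw [Finset.mul_sum]
    refine Finset.sum_le_sum fun j hj => ?_
    rw [Finset.mem_Icc] at hj
    have := mul_le_mul_of_nonneg_left (hle j (by omega))
      (kernelP_nonneg h hβ0 hβ hρ hj.1 hj.2 (by omega))
    linarith
  have h2 : 6 * Λ * ∑ j ∈ Finset.Icc 1 l', kernelP β t l' j * Φ j ≤ 3 * Φ l := by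
    have e1 := sum_kernelP_mul_exp_le h hβ0 hβ hρ hδ hτ (n := l') (by omega)
    have e2 : Φ l' ≤ Φ l := hΦm hl'l (by omega)
    have e3 : 0 ≤ ∑ j ∈ Finset.Icc 1 l', kernelP β t l' j * Φ j :=
      Finset.sum_nonneg fun j hj => by
        rw [Finset.mem_Icc] at hj
        exact mul_nonneg (kernelP_nonneg h hβ0 hβ hρ hj.1 hj.2 (by omega)) (hΦ0 j).le
    have e4 := mul_le_mul_of_nonneg_right hΛ e3
    simp only [hΦ] at e1 e2 e3 e4 ⊢
    linarith
  have h3 : μ * Φ l = M l := by rw [hμ]; field_simp [(hΦ0 l).ne']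
  have h4 : μ * Φ l ≤ 2 * H := by
    have e1 := mul_le_mul_of_nonneg_left h1 hΛ0
    have e2 := mul_le_mul_of_nonneg_left h2 hμ0
    nlinarith
  have h5 : 1 ≤ Φ l := by
    have : Φ 0 = 1 := by simp [hΦ, h.zero]
    exact this ▸ hΦm (Nat.zero_le l) (by omega)
  have h6 : μ ≤ 2 * H := by nlinarith
  have h7 : Φ n ≤ Real.exp (2 / δ * T) := by
    rw [hΦ]
    exact Real.exp_le_exp.2 (mul_le_mul_of_nonneg_left (h.le_last hn) (by positivity))
  calc M n ≤ μ * Φ n := hle n le_rfl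
    _ ≤ 2 * H * Real.exp (2 / δ * T) := mul_le_mul h6 h7 (hΦ0 n).le (hμ0.trans h6)
    _ = _ := by ring

end Mesh

theorem exists_omega_ge {β : ℝ} (hβ0 : 0 < β) (hβ : β < 1) (B : ℝ) :
    ∃ δ > 0, B ≤ omega (1 - β) δ := by
  have hΓ := Real.Gamma_pos_of_pos (show 0 < 1 - β by linarith)
  obtain ⟨C, hC⟩ : ∃ C, C = max 1 (B * Real.Gamma (1 - β)) := ⟨_, rfl⟩
  have hC0 : 0 < C := hC ▸ lt_max_of_lt_left one_pos
  refine ⟨C ^ (-β⁻¹), Real.rpow_pos_of_pos hC0 _, ?_⟩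
  rw [omega, le_div_iff₀ hΓ, ← Real.rpow_mul hC0.le,
    show -β⁻¹ * (1 - β - 1) = 1 by field_simp; ring, Real.rpow_one, hC]
  exact le_max_right _ _

theorem le_maxUpTo {n : ℕ} (hn : 1 ≤ n) (g : ℕ → ℝ) {k : ℕ} (hk0 : 1 ≤ k) (hk : k ≤ n) :
    g k ≤ maxUpTo n hn g :=
  Finset.le_sup' g (Finset.mem_Icc.2 ⟨hk0, hk⟩)

/-- A discrete fractional Grönwall inequality with a constant independent of the mesh. -/
theorem discrete_fractional_gronwall {β T Λ γ : ℝ} (hβ0 : 0 < β) (hβ : β < 1) (hΛ : 0 ≤ Λ)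
    (hγ : 0 ≤ γ) :
    ∃ τmax > 0, ∃ C > 0, ∀ (N : ℕ) (t : ℕ → ℝ), IsTimeMesh T N t →
      (∀ k, 1 ≤ k → k + 1 ≤ N → stepRatio t k ≤ 7 / 4) →
      (∀ k ∈ Set.Icc 1 N, step t k ≤ τmax) →
      ∀ y g : ℕ → ℝ, (∀ k, 0 ≤ y k) → (∀ k, 0 ≤ g k) →
        (∀ n, 1 ≤ n → n ≤ N → discreteCaputo β t (fun k => y k ^ 2) n
          ≤ Λ * max (y n) (y (n - 1)) ^ 2 + γ * max (y n) (y (n - 1)) * g n) →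
        ∀ (n : ℕ) (hn : 1 ≤ n), n ≤ N →
          y n ≤ C * (y 0 + maxUpTo n hn fun k => ∑ j ∈ Finset.Icc 1 k, kernelP β t k j * g j) := by
  obtain ⟨δ, hδ, hΛδ⟩ := exists_omega_ge hβ0 hβ (6 * Λ)
  refine ⟨δ / 2, by positivity, 2 * Real.exp (2 / δ * T) * max 1 γ, by positivity, ?_⟩
  intro N t h hρ hτ y g hy hg hyg n hn hnN
  obtain ⟨G, hG⟩ : ∃ G, G = maxUpTo n hn fun k => ∑ j ∈ Finset.Icc 1 k, kernelP β t k j * g j :=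
    ⟨_, rfl⟩
  rw [← hG]
  have hGk : ∀ k ≤ n, ∑ j ∈ Finset.Icc 1 k, kernelP β t k j * g j ≤ G := by
    have hpos : ∀ k ≤ n, 0 ≤ ∑ j ∈ Finset.Icc 1 k, kernelP β t k j * g j := fun k hk =>
      Finset.sum_nonneg fun j hj => by
        rw [Finset.mem_Icc] at hj
        exact mul_nonneg (kernelP_nonneg h hβ0 hβ hρ hj.1 hj.2 (by omega)) (hg j)
    have h1 : ∀ k, 1 ≤ k → k ≤ n → ∑ j ∈ Finset.Icc 1 k, kernelP β t k j * g j ≤ G :=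
      fun k hk0 hk => hG ▸ le_maxUpTo hn
        (fun k => ∑ j ∈ Finset.Icc 1 k, kernelP β t k j * g j) hk0 hk
    intro k hk
    rcases Nat.eq_zero_or_pos k with rfl | hk0
    · simpa using (hpos n le_rfl).trans (h1 n hn le_rfl)
    · exact h1 k hk0 hk
  have hG0 : 0 ≤ G := by simpa using hGk 0 (Nat.zero_le n)
  have hyM : ∀ {k l}, k ≤ l → y k ≤ partialSups y l := fun hkl => le_partialSups_of_le y hkl
  have hM0 : ∀ l, 0 ≤ partialSups y l := fun l => (hy l).trans (hyM le_rfl)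
  have hM : ∀ l ≤ n, ∃ l' ≤ l, partialSups y l ≤ (y 0 + γ * G)
      + Λ * ∑ j ∈ Finset.Icc 1 l', kernelP β t l' j * partialSups y j := by
    intro l hl
    -- sum the inequality up to a level `l'` attaining the running maximum, and divide by it
    obtain ⟨l', hl'l, hl'⟩ := exists_partialSups_eq y l
    refine ⟨l', hl'l, ?_⟩
    obtain ⟨S, hS⟩ : ∃ S, S = ∑ j ∈ Finset.Icc 1 l', kernelP β t l' j * partialSups y j :=
      ⟨_, rfl⟩
    have hS0 : 0 ≤ S := hS ▸ Finset.sum_nonneg fun j hj => by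
      rw [Finset.mem_Icc] at hj
      exact mul_nonneg (kernelP_nonneg h hβ0 hβ hρ hj.1 hj.2 (by omega)) (hM0 j)
    have hml : 0 ≤ partialSups y l := hM0 l
    have h1 := sum_kernelP_mul_discreteCaputo h hβ0 hβ (fun k => y k ^ 2)
      (by omega : l' ≤ N)
    have h2 : ∑ j ∈ Finset.Icc 1 l', kernelP β t l' j * discreteCaputo β t (fun k => y k ^ 2) j
        ≤ ∑ j ∈ Finset.Icc 1 l', (Λ * partialSups y l * (kernelP β t l' j * partialSups y j)
          + γ * partialSups y l * (kernelP β t l' j * g j)) := by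
      refine Finset.sum_le_sum fun j hj => ?_
      rw [Finset.mem_Icc] at hj
      have hP := kernelP_nonneg h hβ0 hβ hρ hj.1 hj.2 (by omega)
      have e1 : max (y j) (y (j - 1)) ≤ partialSups y j :=
        max_le (hyM le_rfl) (hyM (by omega))
      have e0 : 0 ≤ max (y j) (y (j - 1)) := le_max_of_le_left (hy j)
      have e2 : partialSups y j ≤ partialSups y l := partialSups_monotone y (by omega)
      have e3 : max (y j) (y (j - 1)) ^ 2 ≤ partialSups y l * partialSups y j := by
        rw [sq]; exact mul_le_mul (e1.trans e2) e1 e0 hml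
      have e4 : max (y j) (y (j - 1)) * g j ≤ partialSups y l * g j :=
        mul_le_mul_of_nonneg_right (e1.trans e2) (hg j)
      have e5 := hyg j hj.1 (by omega)
      have e6 : discreteCaputo β t (fun k => y k ^ 2) j
          ≤ Λ * (partialSups y l * partialSups y j) + γ * (partialSups y l * g j) := by
        refine e5.trans ?_
        rw [mul_assoc γ]
        gcongr
      have e7 := mul_le_mul_of_nonneg_left e6 hP
      linarith
    rw [h1, Finset.sum_add_distrib, ← Finset.mul_sum, ← Finset.mul_sum, ← hS] at h2
    rw [← hS]
    have h3 := hGk l' (by omega)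
    have h4 : y 0 ^ 2 ≤ partialSups y l * y 0 := by
      rw [sq]; exact mul_le_mul_of_nonneg_right (hyM (Nat.zero_le l)) (hy 0)
    rcases eq_or_lt_of_le hml with h5 | h5
    · rw [← h5]
      have := hy 0
      positivity
    · refine le_of_mul_le_mul_left ?_ h5
      have h6 := mul_le_mul_of_nonneg_left h3 (mul_nonneg hγ hml)
      have h7 : partialSups y l = y l' := hl'
      have h8 : partialSups y l * partialSups y l = y l' ^ 2 := by rw [h7, sq]
      rw [h8]
      linarith
  have hfin := le_of_le_add_sum_kernelP h hβ0 hβ hρ hδ hτ hΛ hΛδ hnN hM hM0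
  refine (hyM le_rfl).trans (hfin.trans ?_)
  rw [mul_assoc (2 * Real.exp (2 / δ * T))]
  refine mul_le_mul_of_nonneg_left ?_ (by positivity)
  have := mul_le_mul_of_nonneg_right (le_max_left 1 γ) (hy 0)
  have := mul_le_mul_of_nonneg_right (le_max_right 1 γ) hG0
  linarith

/-- The accumulated source is bounded by its maximum in a time-weighted norm. -/
theorem maxUpTo_sum_kernelP_le {T β : ℝ} {N : ℕ} {t : ℕ → ℝ} (h : IsTimeMesh T N t)
    (hβ0 : 0 < β) (hβ : β < 1) (hρ : ∀ k, 1 ≤ k → k + 1 ≤ N → stepRatio t k ≤ 7 / 4)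
    (g : ℕ → ℝ) (hg : ∀ k, 0 ≤ g k) {n : ℕ} (hn : 1 ≤ n) (hnN : n ≤ N) :
    (maxUpTo n hn fun k => ∑ j ∈ Finset.Icc 1 k, kernelP β t k j * g j)
      ≤ Real.Gamma (1 - β) * maxUpTo n hn fun k => t k ^ β * g k := by
  obtain ⟨G, hG⟩ : ∃ G, G = maxUpTo n hn fun k => t k ^ β * g k := ⟨_, rfl⟩
  rw [← hG]
  have hGk : ∀ k, 1 ≤ k → k ≤ n → t k ^ β * g k ≤ G := fun k hk0 hk =>
    hG ▸ le_maxUpTo hn (fun k => t k ^ β * g k) hk0 hk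
  have hG0 : 0 ≤ G :=
    (mul_nonneg (Real.rpow_nonneg (h.nonneg hnN) _) (hg n)).trans (hGk n hn le_rfl)
  refine Finset.sup'_le _ _ fun k hk => ?_
  rw [Finset.mem_Icc] at hk
  have h1 := sum_kernelP_mul_rpow_le h hβ0 hβ hρ hk.1 (by omega)
  refine le_trans ?_ (mul_le_mul_of_nonneg_right h1 hG0)
  rw [Finset.sum_mul]
  refine Finset.sum_le_sum fun j hj => ?_
  rw [Finset.mem_Icc] at hj
  have htj := h.pos hj.1 (by omega)
  have e1 : g j = t j ^ (-β) * (t j ^ β * g j) := by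
    rw [← mul_assoc, ← Real.rpow_add htj]; simp
  have e2 : g j ≤ t j ^ (-β) * G := by
    rw [e1]
    exact mul_le_mul_of_nonneg_left (hGk j hj.1 (by omega)) (Real.rpow_nonneg htj.le _)
  rw [mul_assoc]
  exact mul_le_mul_of_nonneg_left e2 (kernelP_nonneg h hβ0 hβ hρ hj.1 hj.2 (by omega))

/-! ### Linearity of the discrete Caputo derivative -/

theorem discreteCaputo_congr {β : ℝ} {t f g : ℕ → ℝ} {n : ℕ} (hfg : ∀ k ≤ n, f k = g k) :
    discreteCaputo β t f n = discreteCaputo β t g n :=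
  Finset.sum_congr rfl fun k hk => by
    rw [Finset.mem_Icc] at hk
    rw [hfg k hk.2, hfg (k - 1) (by omega)]

theorem discreteCaputo_add (β : ℝ) (t f g : ℕ → ℝ) (n : ℕ) :
    discreteCaputo β t (fun k => f k + g k) n
      = discreteCaputo β t f n + discreteCaputo β t g n := by
  unfold discreteCaputo
  rw [← Finset.sum_add_distrib]
  exact Finset.sum_congr rfl fun k _ => by ring

theorem discreteCaputo_const_mul (β : ℝ) (t : ℕ → ℝ) (c : ℝ) (f : ℕ → ℝ) (n : ℕ) :
    discreteCaputo β t (fun k => c * f k) n = c * discreteCaputo β t f n := by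
  unfold discreteCaputo
  rw [Finset.mul_sum]
  exact Finset.sum_congr rfl fun k _ => by ring

theorem discreteCaputo_diff_quot (β : ℝ) (t f g : ℕ → ℝ) (c : ℝ) (n : ℕ) :
    discreteCaputo β t (fun k => (f k - g k) / c) n
      = (discreteCaputo β t f n - discreteCaputo β t g n) / c := by
  unfold discreteCaputo
  rw [← Finset.sum_sub_distrib, Finset.sum_div]
  exact Finset.sum_congr rfl fun k _ => by ring

theorem discreteCaputo_sum {ι : Type*} (β : ℝ) (t : ℕ → ℝ) (s : Finset ι) (f : ι → ℕ → ℝ)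
    (n : ℕ) :
    discreteCaputo β t (fun k => ∑ i ∈ s, f i k) n = ∑ i ∈ s, discreteCaputo β t (f i) n := by
  unfold discreteCaputo
  rw [Finset.sum_comm]
  refine Finset.sum_congr rfl fun k _ => ?_
  rw [← Finset.sum_sub_distrib, Finset.mul_sum]

theorem offset_diff_quot (β : ℝ) (f g : ℕ → ℝ) (c : ℝ) (n : ℕ) :
    offset β (fun k => (f k - g k) / c) n = (offset β f n - offset β g n) / c := by
  unfold offset; ring

/-! ### Difference calculus on the grid -/

theorem sum_by_parts {V : ℕ → ℝ} (F : ℕ → ℝ) (c : ℝ) {M : ℕ} (hM : 0 < M) (h0 : V 0 = 0)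
    (hV : V M = 0) :
    ∑ i ∈ Finset.Icc 1 (M - 1), V i * ((F i - F (i - 1)) / c)
      = -∑ i ∈ Finset.range M, F i * ((V (i + 1) - V i) / c) := by
  have key : ∀ m, ∑ i ∈ Finset.Icc 1 m, V i * ((F i - F (i - 1)) / c)
      + ∑ i ∈ Finset.range (m + 1), F i * ((V (i + 1) - V i) / c)
      = (V (m + 1) * F m - V 0 * F 0) / c := by
    intro m
    induction m with
    | zero => simp; ring
    | succ m ih =>
      rw [Finset.sum_Icc_succ_top (by omega), Finset.sum_range_succ]
      simp only [Nat.add_sub_cancel]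
      linear_combination ih
  obtain ⟨m, rfl⟩ : ∃ m, M = m + 1 := ⟨M - 1, by omega⟩
  have := key m
  rw [h0, hV] at this
  simp only [Nat.add_sub_cancel]
  linear_combination this

theorem sum_Icc_le_sum_range {a : ℕ → ℝ} (ha : ∀ i, 0 ≤ a i) (M : ℕ) :
    ∑ i ∈ Finset.Icc 1 (M - 1), a i ≤ ∑ i ∈ Finset.range M, a i :=
  Finset.sum_le_sum_of_subset_of_nonneg
    (fun i hi => by rw [Finset.mem_Icc] at hi; rw [Finset.mem_range]; omega) fun i _ _ => ha i

theorem sum_Icc_pred_le_sum_range {a : ℕ → ℝ} (ha : ∀ i, 0 ≤ a i) (M : ℕ) :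
    ∑ i ∈ Finset.Icc 1 (M - 1), a (i - 1) ≤ ∑ i ∈ Finset.range M, a i := by
  rw [← Finset.sum_image (f := a) (g := fun i => i - 1) (s := Finset.Icc 1 (M - 1))]
  · refine Finset.sum_le_sum_of_subset_of_nonneg (fun i hi => ?_) fun i _ _ => ha i
    simp only [Finset.mem_image, Finset.mem_Icc, Finset.mem_range] at hi ⊢
    omega
  · intro i hi j hj hij
    simp only [Finset.coe_Icc, Set.mem_Icc] at hi hj hij
    omega

theorem sum_sq_central_le {U : ℕ → ℝ} (c : ℝ) (M : ℕ) :
    ∑ i ∈ Finset.Icc 1 (M - 1), ((U (i + 1) - U (i - 1)) / (2 * c)) ^ 2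
      ≤ ∑ i ∈ Finset.range M, ((U (i + 1) - U i) / c) ^ 2 := by
  have h1 : ∑ i ∈ Finset.Icc 1 (M - 1), ((U (i + 1) - U (i - 1)) / (2 * c)) ^ 2
      ≤ ∑ i ∈ Finset.Icc 1 (M - 1), (1 / 2 * ((U (i + 1) - U i) / c) ^ 2
        + 1 / 2 * ((U (i - 1 + 1) - U (i - 1)) / c) ^ 2) := by
    refine Finset.sum_le_sum fun i hi => ?_
    rw [Finset.mem_Icc] at hi
    rw [show i - 1 + 1 = i by omega]
    have e : (U (i + 1) - U (i - 1)) / (2 * c)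
        = ((U (i + 1) - U i) / c + (U i - U (i - 1)) / c) / 2 := by ring
    rw [e]
    nlinarith [sq_nonneg ((U (i + 1) - U i) / c - (U i - U (i - 1)) / c)]
  rw [Finset.sum_add_distrib, ← Finset.mul_sum, ← Finset.mul_sum] at h1
  have h2 := sum_Icc_le_sum_range (fun i => sq_nonneg ((U (i + 1) - U i) / c)) M
  have h3 := sum_Icc_pred_le_sum_range (fun i => sq_nonneg ((U (i + 1) - U i) / c)) M
  linarith

/-- The discrete Poincaré inequality on an interval of length `M c`. -/
theorem sum_sq_le_sum_sq_diff {U : ℕ → ℝ} {c : ℝ} (hc : c ≠ 0) (M : ℕ) (h0 : U 0 = 0) :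
    ∑ i ∈ Finset.Icc 1 (M - 1), U i ^ 2
      ≤ (M * c) ^ 2 * ∑ i ∈ Finset.range M, ((U (i + 1) - U i) / c) ^ 2 := by
  obtain ⟨S, hS⟩ : ∃ S, S = ∑ i ∈ Finset.range M, ((U (i + 1) - U i) / c) ^ 2 := ⟨_, rfl⟩
  rw [← hS]
  have hS0 : 0 ≤ S := hS ▸ Finset.sum_nonneg fun i _ => sq_nonneg _
  have h1 : ∀ i ∈ Finset.Icc 1 (M - 1), U i ^ 2 ≤ M * c ^ 2 * S := by
    intro i hi
    rw [Finset.mem_Icc] at hi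
    have e1 : U i = c * ∑ l ∈ Finset.range i, (U (l + 1) - U l) / c := by
      rw [← Finset.sum_div, Finset.sum_range_sub, h0, sub_zero]
      field_simp
    have e2 : (∑ l ∈ Finset.range i, (U (l + 1) - U l) / c) ^ 2
        ≤ i * ∑ l ∈ Finset.range i, ((U (l + 1) - U l) / c) ^ 2 := by
      have := sq_sum_le_card_mul_sum_sq (s := Finset.range i)
        (f := fun l => (U (l + 1) - U l) / c)
      simpa using this
    have e3 : ∑ l ∈ Finset.range i, ((U (l + 1) - U l) / c) ^ 2 ≤ S := by
      rw [hS]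
      exact Finset.sum_le_sum_of_subset_of_nonneg
        (Finset.range_subset_range.2 (by omega)) fun _ _ _ => sq_nonneg _
    have e4 : (i : ℝ) ≤ M := by exact_mod_cast (by omega : i ≤ M)
    rw [e1, mul_pow]
    calc _ ≤ c ^ 2 * (M * S) := by
          refine mul_le_mul_of_nonneg_left (e2.trans ?_) (sq_nonneg c)
          exact mul_le_mul e4 e3 (Finset.sum_nonneg fun _ _ => sq_nonneg _) (Nat.cast_nonneg M)
      _ = _ := by ring
  refine (Finset.sum_le_card_nsmul _ _ _ h1).trans ?_
  rw [nsmul_eq_mul, Nat.card_Icc]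
  have e5 : ((M - 1 + 1 - 1 : ℕ) : ℝ) ≤ M := by exact_mod_cast (by omega)
  calc _ ≤ (M : ℝ) * (M * c ^ 2 * S) := mul_le_mul_of_nonneg_right e5 (by positivity)
    _ = _ := by ring

/-! ### The discrete energy -/

/-- The discrete energy of the pair `(v, w)`: the weighted sum of the squares of `v` at the interior
nodes and of the difference quotients of `w` along the edges. The weight `q₁ i j` belongs to the
edge from `(i, j)` to `(i + 1, j)`, and `q₂ i j` to the edge from `(i, j)` to `(i, j + 1)`. -/
noncomputable def energy (hx hy : ℝ) (Mx My : ℕ) (q q₁ q₂ v w : ℕ → ℕ → ℝ) : ℝ :=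
  hx * hy * (∑ i ∈ Finset.Icc 1 (Mx - 1), ∑ j ∈ Finset.Icc 1 (My - 1), q i j * v i j ^ 2
    + ∑ i ∈ Finset.range Mx, ∑ j ∈ Finset.Icc 1 (My - 1),
        q₁ i j * ((w (i + 1) j - w i j) / hx) ^ 2
    + ∑ i ∈ Finset.Icc 1 (Mx - 1), ∑ j ∈ Finset.range My,
        q₂ i j * ((w i (j + 1) - w i j) / hy) ^ 2)

/-- Testing the discrete Caputo derivative of the energy: if `V = D w` on the closed grid and `V`
vanishes on the boundary, the elliptic part is moved onto the operator `δₓ[q₁ δₓ] + δᵧ[q₂ δᵧ]` by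
summation by parts. -/
theorem discreteCaputo_energy_le {T β : ℝ} {N : ℕ} {t : ℕ → ℝ} (h : IsTimeMesh T N t)
    (hβ0 : 0 < β) (hβ : β < 1) (hρ : ∀ k, 1 ≤ k → k + 1 ≤ N → stepRatio t k ≤ 7 / 4)
    {hx hy : ℝ} (hhx : 0 < hx) (hhy : 0 < hy) {Mx My : ℕ} (hMx : 0 < Mx) (hMy : 0 < My)
    {q q₁ q₂ v w : ℕ → ℕ → ℕ → ℝ} {n : ℕ} (hn0 : 1 ≤ n) (hn : n ≤ N)
    (hq : ∀ i ∈ Finset.Icc 1 (Mx - 1), ∀ j ∈ Finset.Icc 1 (My - 1),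
      0 ≤ q n i j ∧ ∀ k ≤ n, q n i j ≤ q k i j)
    (hq₁ : ∀ i ∈ Finset.range Mx, ∀ j ∈ Finset.Icc 1 (My - 1),
      0 ≤ q₁ n i j ∧ ∀ k ≤ n, q₁ n i j ≤ q₁ k i j)
    (hq₂ : ∀ i ∈ Finset.Icc 1 (Mx - 1), ∀ j ∈ Finset.range My,
      0 ≤ q₂ n i j ∧ ∀ k ≤ n, q₂ n i j ≤ q₂ k i j)
    {U V : ℕ → ℕ → ℝ} (hU : ∀ i j, U i j = offset β (fun k => w k i j) n)
    (hV : ∀ i j, V i j = offset β (fun k => v k i j) n)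
    (hVw : ∀ i ≤ Mx, ∀ j ≤ My, V i j = discreteCaputo β t (fun k => w k i j) n)
    (hV0 : ∀ i ≤ Mx, ∀ j ≤ My, (i = 0 ∨ i = Mx ∨ j = 0 ∨ j = My) → V i j = 0) :
    discreteCaputo β t (fun k => energy hx hy Mx My (q k) (q₁ k) (q₂ k) (v k) (w k)) n
      ≤ hx * hy * ∑ i ∈ Finset.Icc 1 (Mx - 1), ∑ j ∈ Finset.Icc 1 (My - 1),
        2 * (V i j * (q n i j * discreteCaputo β t (fun k => v k i j) n
          - ((q₁ n i j * ((U (i + 1) j - U i j) / hx)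
              - q₁ n (i - 1) j * ((U (i - 1 + 1) j - U (i - 1) j) / hx)) / hx
            + (q₂ n i j * ((U i (j + 1) - U i j) / hy)
              - q₂ n i (j - 1) * ((U i (j - 1 + 1) - U i (j - 1)) / hy)) / hy))) := by
  simp only [energy]
  rw [discreteCaputo_const_mul, discreteCaputo_add, discreteCaputo_add]
  simp only [discreteCaputo_sum]
  refine mul_le_mul_of_nonneg_left ?_ (mul_pos hhx hhy).le
  have h1 : ∑ i ∈ Finset.Icc 1 (Mx - 1), ∑ j ∈ Finset.Icc 1 (My - 1),
        discreteCaputo β t (fun k => q k i j * v k i j ^ 2) n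
      ≤ ∑ i ∈ Finset.Icc 1 (Mx - 1), ∑ j ∈ Finset.Icc 1 (My - 1),
        2 * (V i j * (q n i j * discreteCaputo β t (fun k => v k i j) n)) := by
    refine Finset.sum_le_sum fun i hi => Finset.sum_le_sum fun j hj => ?_
    refine (discreteCaputo_mul_sq_le h hβ0 hβ hρ hn0 hn (hq i hi j hj).1 (hq i hi j hj).2).trans
      (le_of_eq ?_)
    rw [hV]; ring
  have h2 : ∑ i ∈ Finset.range Mx, ∑ j ∈ Finset.Icc 1 (My - 1),
        discreteCaputo β t (fun k => q₁ k i j * ((w k (i + 1) j - w k i j) / hx) ^ 2) n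
      ≤ ∑ i ∈ Finset.range Mx, ∑ j ∈ Finset.Icc 1 (My - 1),
        2 * ((q₁ n i j * ((U (i + 1) j - U i j) / hx)) * ((V (i + 1) j - V i j) / hx)) := by
    refine Finset.sum_le_sum fun i hi => Finset.sum_le_sum fun j hj => ?_
    refine (discreteCaputo_mul_sq_le h hβ0 hβ hρ (w := fun k => (w k (i + 1) j - w k i j) / hx)
      hn0 hn (hq₁ i hi j hj).1 (hq₁ i hi j hj).2).trans (le_of_eq ?_)
    rw [Finset.mem_range] at hi
    rw [Finset.mem_Icc] at hj
    rw [discreteCaputo_diff_quot, offset_diff_quot, hU, hU, hVw (i + 1) (by omega) j (by omega),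
      hVw i (by omega) j (by omega)]
    ring
  have h3 : ∑ i ∈ Finset.Icc 1 (Mx - 1), ∑ j ∈ Finset.range My,
        discreteCaputo β t (fun k => q₂ k i j * ((w k i (j + 1) - w k i j) / hy) ^ 2) n
      ≤ ∑ i ∈ Finset.Icc 1 (Mx - 1), ∑ j ∈ Finset.range My,
        2 * ((q₂ n i j * ((U i (j + 1) - U i j) / hy)) * ((V i (j + 1) - V i j) / hy)) := by
    refine Finset.sum_le_sum fun i hi => Finset.sum_le_sum fun j hj => ?_
    refine (discreteCaputo_mul_sq_le h hβ0 hβ hρ (w := fun k => (w k i (j + 1) - w k i j) / hy)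
      hn0 hn (hq₂ i hi j hj).1 (hq₂ i hi j hj).2).trans (le_of_eq ?_)
    rw [Finset.mem_range] at hj
    rw [Finset.mem_Icc] at hi
    rw [discreteCaputo_diff_quot, offset_diff_quot, hU, hU, hVw i (by omega) (j + 1) (by omega),
      hVw i (by omega) j (by omega)]
    ring
  have h2' : ∑ i ∈ Finset.range Mx, ∑ j ∈ Finset.Icc 1 (My - 1),
        2 * ((q₁ n i j * ((U (i + 1) j - U i j) / hx)) * ((V (i + 1) j - V i j) / hx))
      = -∑ i ∈ Finset.Icc 1 (Mx - 1), ∑ j ∈ Finset.Icc 1 (My - 1),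
        2 * (V i j * ((q₁ n i j * ((U (i + 1) j - U i j) / hx)
              - q₁ n (i - 1) j * ((U (i - 1 + 1) j - U (i - 1) j) / hx)) / hx)) := by
    rw [Finset.sum_comm, Finset.sum_comm (s := Finset.Icc 1 (Mx - 1)), ← Finset.sum_neg_distrib]
    refine Finset.sum_congr rfl fun j hj => ?_
    rw [Finset.mem_Icc] at hj
    rw [← Finset.mul_sum, ← Finset.mul_sum, sum_by_parts (V := fun i => V i j)
      (fun i => q₁ n i j * ((U (i + 1) j - U i j) / hx)) hx hMx
      (hV0 0 (by omega) j (by omega) (by omega)) (hV0 Mx le_rfl j (by omega) (by omega))]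
    ring
  have h3' : ∑ i ∈ Finset.Icc 1 (Mx - 1), ∑ j ∈ Finset.range My,
        2 * ((q₂ n i j * ((U i (j + 1) - U i j) / hy)) * ((V i (j + 1) - V i j) / hy))
      = -∑ i ∈ Finset.Icc 1 (Mx - 1), ∑ j ∈ Finset.Icc 1 (My - 1),
        2 * (V i j * ((q₂ n i j * ((U i (j + 1) - U i j) / hy)
              - q₂ n i (j - 1) * ((U i (j - 1 + 1) - U i (j - 1)) / hy)) / hy)) := by
    rw [← Finset.sum_neg_distrib]
    refine Finset.sum_congr rfl fun i hi => ?_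
    rw [Finset.mem_Icc] at hi
    rw [← Finset.mul_sum, ← Finset.mul_sum, sum_by_parts (V := fun j => V i j)
      (fun j => q₂ n i j * ((U i (j + 1) - U i j) / hy)) hy hMy
      (hV0 i (by omega) 0 (by omega) (by omega)) (hV0 i (by omega) My le_rfl (by omega))]
    ring
  refine (add_le_add (add_le_add h1 h2) h3).trans (le_of_eq ?_)
  rw [h2', h3', ← sub_eq_add_neg, ← sub_eq_add_neg, ← Finset.sum_sub_distrib,
    ← Finset.sum_sub_distrib]
  refine Finset.sum_congr rfl fun i _ => ?_
  rw [← Finset.sum_sub_distrib, ← Finset.sum_sub_distrib]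
  exact Finset.sum_congr rfl fun j _ => by ring

/-! ### The discrete norms -/

section Norms

variable {Ω : Rect} {Mx My : ℕ}

theorem Rect.stepX_pos (Ω : Rect) (hMx : 0 < Mx) : 0 < Ω.stepX Mx :=
  div_pos (sub_pos.2 Ω.hx) (Nat.cast_pos.2 hMx)

theorem Rect.stepY_pos (Ω : Rect) (hMy : 0 < My) : 0 < Ω.stepY My :=
  div_pos (sub_pos.2 Ω.hy) (Nat.cast_pos.2 hMy)

theorem Rect.stepX_mul_stepY_nonneg (Ω : Rect) (Mx My : ℕ) : 0 ≤ Ω.stepX Mx * Ω.stepY My :=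
  mul_nonneg (div_nonneg (sub_pos.2 Ω.hx).le (Nat.cast_nonneg Mx))
    (div_nonneg (sub_pos.2 Ω.hy).le (Nat.cast_nonneg My))

theorem norm₂_sq (Ω : Rect) (Mx My : ℕ) (w : ℕ → ℕ → ℝ) :
    norm₂ Ω Mx My w ^ 2 = Ω.stepX Mx * Ω.stepY My *
      ∑ i ∈ Finset.Icc 1 (Mx - 1), ∑ j ∈ Finset.Icc 1 (My - 1), w i j ^ 2 :=
  Real.sq_sqrt (mul_nonneg (Ω.stepX_mul_stepY_nonneg Mx My)
    (Finset.sum_nonneg fun _ _ => Finset.sum_nonneg fun _ _ => sq_nonneg _))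

theorem normDx_sq (Ω : Rect) (Mx My : ℕ) (w : ℕ → ℕ → ℝ) :
    normDx Ω Mx My w ^ 2 = Ω.stepX Mx * Ω.stepY My *
      ∑ i ∈ Finset.range Mx, ∑ j ∈ Finset.Icc 1 (My - 1),
        ((w (i + 1) j - w i j) / Ω.stepX Mx) ^ 2 :=
  Real.sq_sqrt (mul_nonneg (Ω.stepX_mul_stepY_nonneg Mx My)
    (Finset.sum_nonneg fun _ _ => Finset.sum_nonneg fun _ _ => sq_nonneg _))

theorem normDy_sq (Ω : Rect) (Mx My : ℕ) (w : ℕ → ℕ → ℝ) :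
    normDy Ω Mx My w ^ 2 = Ω.stepX Mx * Ω.stepY My *
      ∑ i ∈ Finset.Icc 1 (Mx - 1), ∑ j ∈ Finset.range My,
        ((w i (j + 1) - w i j) / Ω.stepY My) ^ 2 :=
  Real.sq_sqrt (mul_nonneg (Ω.stepX_mul_stepY_nonneg Mx My)
    (Finset.sum_nonneg fun _ _ => Finset.sum_nonneg fun _ _ => sq_nonneg _))

theorem normGrad_sq (Ω : Rect) (Mx My : ℕ) (w : ℕ → ℕ → ℝ) :
    normGrad Ω Mx My w ^ 2 = normDx Ω Mx My w ^ 2 + normDy Ω Mx My w ^ 2 :=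
  Real.sq_sqrt (by positivity)

theorem normGrad_congr {w w' : ℕ → ℕ → ℝ} (hw : ∀ i ≤ Mx, ∀ j ≤ My, w i j = w' i j) :
    normGrad Ω Mx My w = normGrad Ω Mx My w' := by
  have h1 : normDx Ω Mx My w = normDx Ω Mx My w' := by
    unfold normDx
    congr 2
    refine Finset.sum_congr rfl fun i hi => Finset.sum_congr rfl fun j hj => ?_
    rw [Finset.mem_range] at hi
    rw [Finset.mem_Icc] at hj
    rw [hw (i + 1) (by omega) j (by omega), hw i (by omega) j (by omega)]
  have h2 : normDy Ω Mx My w = normDy Ω Mx My w' := by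
    unfold normDy
    congr 2
    refine Finset.sum_congr rfl fun i hi => Finset.sum_congr rfl fun j hj => ?_
    rw [Finset.mem_range] at hj
    rw [Finset.mem_Icc] at hi
    rw [hw i (by omega) (j + 1) (by omega), hw i (by omega) j (by omega)]
  unfold normGrad
  rw [h1, h2]

theorem normDx_sq_combination_le (Ω : Rect) (Mx My : ℕ) {a b : ℝ} (ha : 0 ≤ a) (hb : 0 ≤ b)
    (w w' : ℕ → ℕ → ℝ) :
    normDx Ω Mx My (fun i j => a * w i j + b * w' i j) ^ 2
      ≤ (a + b) * (a * normDx Ω Mx My w ^ 2 + b * normDx Ω Mx My w' ^ 2) := by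
  have e : ∀ A B C : ℝ, (a + b) * (a * (C * A) + b * (C * B))
      = C * ((a + b) * (a * A + b * B)) := by intros; ring
  rw [normDx_sq, normDx_sq, normDx_sq, e]
  refine mul_le_mul_of_nonneg_left ?_ (Ω.stepX_mul_stepY_nonneg Mx My)
  simp only [Finset.mul_sum, ← Finset.sum_add_distrib]
  refine Finset.sum_le_sum fun i _ => Finset.sum_le_sum fun j _ => ?_
  have e1 : (a * w (i + 1) j + b * w' (i + 1) j - (a * w i j + b * w' i j)) / Ω.stepX Mx
      = a * ((w (i + 1) j - w i j) / Ω.stepX Mx)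
        + b * ((w' (i + 1) j - w' i j) / Ω.stepX Mx) := by ring
  rw [e1]
  nlinarith [mul_nonneg (mul_nonneg ha hb) (sq_nonneg ((w (i + 1) j - w i j) / Ω.stepX Mx
    - (w' (i + 1) j - w' i j) / Ω.stepX Mx))]

theorem normDy_sq_combination_le (Ω : Rect) (Mx My : ℕ) {a b : ℝ} (ha : 0 ≤ a) (hb : 0 ≤ b)
    (w w' : ℕ → ℕ → ℝ) :
    normDy Ω Mx My (fun i j => a * w i j + b * w' i j) ^ 2
      ≤ (a + b) * (a * normDy Ω Mx My w ^ 2 + b * normDy Ω Mx My w' ^ 2) := by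
  have e : ∀ A B C : ℝ, (a + b) * (a * (C * A) + b * (C * B))
      = C * ((a + b) * (a * A + b * B)) := by intros; ring
  rw [normDy_sq, normDy_sq, normDy_sq, e]
  refine mul_le_mul_of_nonneg_left ?_ (Ω.stepX_mul_stepY_nonneg Mx My)
  simp only [Finset.mul_sum, ← Finset.sum_add_distrib]
  refine Finset.sum_le_sum fun i _ => Finset.sum_le_sum fun j _ => ?_
  have e1 : (a * w i (j + 1) + b * w' i (j + 1) - (a * w i j + b * w' i j)) / Ω.stepY My
      = a * ((w i (j + 1) - w i j) / Ω.stepY My)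
        + b * ((w' i (j + 1) - w' i j) / Ω.stepY My) := by ring
  rw [e1]
  nlinarith [mul_nonneg (mul_nonneg ha hb) (sq_nonneg ((w i (j + 1) - w i j) / Ω.stepY My
    - (w' i (j + 1) - w' i j) / Ω.stepY My))]

theorem norm₂_sq_combination_le (Ω : Rect) (Mx My : ℕ) {a b : ℝ} (ha : 0 ≤ a) (hb : 0 ≤ b)
    (w w' : ℕ → ℕ → ℝ) :
    norm₂ Ω Mx My (fun i j => a * w i j + b * w' i j) ^ 2
      ≤ (a + b) * (a * norm₂ Ω Mx My w ^ 2 + b * norm₂ Ω Mx My w' ^ 2) := by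
  have e : ∀ A B C : ℝ, (a + b) * (a * (C * A) + b * (C * B))
      = C * ((a + b) * (a * A + b * B)) := by intros; ring
  rw [norm₂_sq, norm₂_sq, norm₂_sq, e]
  refine mul_le_mul_of_nonneg_left ?_ (Ω.stepX_mul_stepY_nonneg Mx My)
  simp only [Finset.mul_sum, ← Finset.sum_add_distrib]
  refine Finset.sum_le_sum fun i _ => Finset.sum_le_sum fun j _ => ?_
  nlinarith [mul_nonneg (mul_nonneg ha hb) (sq_nonneg (w i j - w' i j))]

theorem sum_abs_mul_abs_le_norm₂ (Ω : Rect) (Mx My : ℕ) (w w' : ℕ → ℕ → ℝ) :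
    Ω.stepX Mx * Ω.stepY My *
        ∑ i ∈ Finset.Icc 1 (Mx - 1), ∑ j ∈ Finset.Icc 1 (My - 1), |w i j| * |w' i j|
      ≤ norm₂ Ω Mx My w * norm₂ Ω Mx My w' := by
  have hh := Ω.stepX_mul_stepY_nonneg Mx My
  have h1 := Real.sum_mul_le_sqrt_mul_sqrt
    (Finset.Icc 1 (Mx - 1) ×ˢ Finset.Icc 1 (My - 1)) (fun z => |w z.1 z.2|)
    (fun z => |w' z.1 z.2|)
  simp only [sq_abs, Finset.sum_product] at h1
  refine (mul_le_mul_of_nonneg_left h1 hh).trans (le_of_eq ?_)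
  unfold norm₂
  rw [Real.sqrt_mul hh, Real.sqrt_mul hh]
  linear_combination (-√(∑ i ∈ Finset.Icc 1 (Mx - 1), ∑ j ∈ Finset.Icc 1 (My - 1), w i j ^ 2)
    * √(∑ i ∈ Finset.Icc 1 (Mx - 1), ∑ j ∈ Finset.Icc 1 (My - 1), w' i j ^ 2))
    * Real.mul_self_sqrt hh

theorem normGrad_add_mul_le (Ω : Rect) (Mx My : ℕ) {s : ℝ} (hs : 0 ≤ s) (w w' : ℕ → ℕ → ℝ) :
    normGrad Ω Mx My (fun i j => w i j + s * w' i j)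
      ≤ 2 * (normGrad Ω Mx My w + s * normGrad Ω Mx My w') := by
  have g0 : 0 ≤ normGrad Ω Mx My w := Real.sqrt_nonneg _
  have g1 : 0 ≤ normGrad Ω Mx My w' := Real.sqrt_nonneg _
  refine abs_le_of_sq_le_sq' ?_ (by positivity) |>.2
  have hx := normDx_sq_combination_le Ω Mx My zero_le_one zero_le_one w (fun i j => s * w' i j)
  have hy := normDy_sq_combination_le Ω Mx My zero_le_one zero_le_one w (fun i j => s * w' i j)
  have hx' := normDx_sq_combination_le Ω Mx My hs le_rfl w' w'
  have hy' := normDy_sq_combination_le Ω Mx My hs le_rfl w' w'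
  simp only [one_mul, zero_mul, add_zero] at hx hy hx' hy'
  have e := normGrad_sq Ω Mx My w
  have e' := normGrad_sq Ω Mx My w'
  have e'' := congrArg (s ^ 2 * ·) e'
  rw [normGrad_sq]
  nlinarith [mul_nonneg g0 (mul_nonneg hs g1), sq_nonneg (normGrad Ω Mx My w),
    sq_nonneg (s * normGrad Ω Mx My w')]

theorem sum_sq_centralX_le (Ω : Rect) (Mx My : ℕ) (U : ℕ → ℕ → ℝ) :
    Ω.stepX Mx * Ω.stepY My * ∑ i ∈ Finset.Icc 1 (Mx - 1), ∑ j ∈ Finset.Icc 1 (My - 1),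
        ((U (i + 1) j - U (i - 1) j) / (2 * Ω.stepX Mx)) ^ 2 ≤ normDx Ω Mx My U ^ 2 := by
  rw [normDx_sq]
  refine mul_le_mul_of_nonneg_left ?_ (Ω.stepX_mul_stepY_nonneg Mx My)
  rw [Finset.sum_comm, Finset.sum_comm (s := Finset.range Mx)]
  exact Finset.sum_le_sum fun j _ => sum_sq_central_le (U := fun i => U i j) _ _

theorem sum_sq_centralY_le (Ω : Rect) (Mx My : ℕ) (U : ℕ → ℕ → ℝ) :
    Ω.stepX Mx * Ω.stepY My * ∑ i ∈ Finset.Icc 1 (Mx - 1), ∑ j ∈ Finset.Icc 1 (My - 1),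
        ((U i (j + 1) - U i (j - 1)) / (2 * Ω.stepY My)) ^ 2 ≤ normDy Ω Mx My U ^ 2 := by
  rw [normDy_sq]
  refine mul_le_mul_of_nonneg_left ?_ (Ω.stepX_mul_stepY_nonneg Mx My)
  exact Finset.sum_le_sum fun i _ => sum_sq_central_le (U := fun j => U i j) _ _

theorem norm₂_sq_le_normDx_sq (Ω : Rect) (hMx : 0 < Mx) (My : ℕ) {U : ℕ → ℕ → ℝ}
    (hU : ∀ j ∈ Finset.Icc 1 (My - 1), U 0 j = 0) :
    norm₂ Ω Mx My U ^ 2 ≤ (Ω.xr - Ω.xl) ^ 2 * normDx Ω Mx My U ^ 2 := by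
  rw [norm₂_sq, normDx_sq, mul_left_comm]
  refine mul_le_mul_of_nonneg_left ?_ (Ω.stepX_mul_stepY_nonneg Mx My)
  have e : Ω.xr - Ω.xl = Mx * Ω.stepX Mx := by
    have : (Mx : ℝ) ≠ 0 := Nat.cast_ne_zero.2 hMx.ne'
    unfold Rect.stepX; field_simp
  rw [Finset.sum_comm, Finset.sum_comm (s := Finset.range Mx), e, Finset.mul_sum]
  exact Finset.sum_le_sum fun j hj =>
    sum_sq_le_sum_sq_diff (U := fun i => U i j) (Ω.stepX_pos hMx).ne' Mx (hU j hj)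

/-- The energy with weights at least `m` controls `‖v‖`, `‖δₓ w‖` and `‖δᵧ w‖`. -/
theorem mul_norms_le_energy (Ω : Rect) (Mx My : ℕ) {m : ℝ} {q q₁ q₂ : ℕ → ℕ → ℝ}
    (v w : ℕ → ℕ → ℝ)
    (hq : ∀ i ∈ Finset.Icc 1 (Mx - 1), ∀ j ∈ Finset.Icc 1 (My - 1), m ≤ q i j)
    (hq₁ : ∀ i ∈ Finset.range Mx, ∀ j ∈ Finset.Icc 1 (My - 1), m ≤ q₁ i j)
    (hq₂ : ∀ i ∈ Finset.Icc 1 (Mx - 1), ∀ j ∈ Finset.range My, m ≤ q₂ i j) :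
    m * (norm₂ Ω Mx My v ^ 2 + normDx Ω Mx My w ^ 2 + normDy Ω Mx My w ^ 2)
      ≤ energy (Ω.stepX Mx) (Ω.stepY My) Mx My q q₁ q₂ v w := by
  rw [norm₂_sq, normDx_sq, normDy_sq, energy, ← mul_add, ← mul_add, mul_left_comm]
  refine mul_le_mul_of_nonneg_left ?_ (Ω.stepX_mul_stepY_nonneg Mx My)
  simp only [mul_add, Finset.mul_sum]
  refine add_le_add (add_le_add ?_ ?_) ?_ <;>
  refine Finset.sum_le_sum fun i hi => Finset.sum_le_sum fun j hj =>
    mul_le_mul_of_nonneg_right ?_ (sq_nonneg _)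
  exacts [hq i hi j hj, hq₁ i hi j hj, hq₂ i hi j hj]

theorem energy_le_mul_normGrad_sq (Ω : Rect) (Mx My : ℕ) {K : ℝ} {q q₁ q₂ v : ℕ → ℕ → ℝ}
    (w : ℕ → ℕ → ℝ)
    (hv : ∀ i ∈ Finset.Icc 1 (Mx - 1), ∀ j ∈ Finset.Icc 1 (My - 1), v i j = 0)
    (hq₁ : ∀ i ∈ Finset.range Mx, ∀ j ∈ Finset.Icc 1 (My - 1), q₁ i j ≤ K)
    (hq₂ : ∀ i ∈ Finset.Icc 1 (Mx - 1), ∀ j ∈ Finset.range My, q₂ i j ≤ K) :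
    energy (Ω.stepX Mx) (Ω.stepY My) Mx My q q₁ q₂ v w ≤ K * normGrad Ω Mx My w ^ 2 := by
  have h0 : ∑ i ∈ Finset.Icc 1 (Mx - 1), ∑ j ∈ Finset.Icc 1 (My - 1), q i j * v i j ^ 2 = 0 :=
    Finset.sum_eq_zero fun i hi => Finset.sum_eq_zero fun j hj => by rw [hv i hi j hj]; ring
  rw [normGrad_sq, normDx_sq, normDy_sq, energy, h0, zero_add, ← mul_add, mul_left_comm]
  refine mul_le_mul_of_nonneg_left ?_ (Ω.stepX_mul_stepY_nonneg Mx My)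
  simp only [mul_add, Finset.mul_sum]
  refine add_le_add ?_ ?_ <;>
  refine Finset.sum_le_sum fun i hi => Finset.sum_le_sum fun j hj =>
    mul_le_mul_of_nonneg_right ?_ (sq_nonneg _)
  exacts [hq₁ i hi j hj, hq₂ i hi j hj]

/-- The lower-order terms and the source, tested with `q V`: Young's inequality for the
former, the Cauchy–Schwarz inequality for the source `f + g`, and the Poincaré inequality for the
term of order zero. -/
theorem sum_lower_order_le (Ω : Rect) (hMx : 0 < Mx) (My : ℕ) {K : ℝ} (hK : 0 < K)
    {q r₁ r₂ r₃ U V f g : ℕ → ℕ → ℝ}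
    (hU : ∀ j ∈ Finset.Icc 1 (My - 1), U 0 j = 0)
    (hq : ∀ i ∈ Finset.Icc 1 (Mx - 1), ∀ j ∈ Finset.Icc 1 (My - 1),
      |q i j| ≤ K ∧ |r₁ i j| ≤ K ∧ |r₂ i j| ≤ K ∧ |r₃ i j| ≤ K) :
    Ω.stepX Mx * Ω.stepY My * ∑ i ∈ Finset.Icc 1 (Mx - 1), ∑ j ∈ Finset.Icc 1 (My - 1),
        2 * (V i j * (q i j * (r₁ i j * ((U (i + 1) j - U (i - 1) j) / (2 * Ω.stepX Mx))
          + r₂ i j * ((U i (j + 1) - U i (j - 1)) / (2 * Ω.stepY My))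
          + r₃ i j * U i j + f i j + g i j)))
      ≤ K ^ 2 * (3 * norm₂ Ω Mx My V ^ 2 + (1 + (Ω.xr - Ω.xl) ^ 2) * normDx Ω Mx My U ^ 2
          + normDy Ω Mx My U ^ 2)
        + 2 * K * (norm₂ Ω Mx My V * (norm₂ Ω Mx My f + norm₂ Ω Mx My g)) := by
  have hh := Ω.stepX_mul_stepY_nonneg Mx My
  have hpt : ∀ i ∈ Finset.Icc 1 (Mx - 1), ∀ j ∈ Finset.Icc 1 (My - 1),
      2 * (V i j * (q i j * (r₁ i j * ((U (i + 1) j - U (i - 1) j) / (2 * Ω.stepX Mx))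
          + r₂ i j * ((U i (j + 1) - U i (j - 1)) / (2 * Ω.stepY My))
          + r₃ i j * U i j + f i j + g i j)))
      ≤ 3 * K ^ 2 * V i j ^ 2 + K ^ 2 * ((U (i + 1) j - U (i - 1) j) / (2 * Ω.stepX Mx)) ^ 2
        + K ^ 2 * ((U i (j + 1) - U i (j - 1)) / (2 * Ω.stepY My)) ^ 2 + K ^ 2 * U i j ^ 2
        + 2 * K * (|V i j| * |f i j|) + 2 * K * (|V i j| * |g i j|) := by
    intro i hi j hj
    obtain ⟨h0, h1, h2, h3⟩ := hq i hi j hj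
    have quad : ∀ r X : ℝ, |r| ≤ K →
        2 * (V i j * (q i j * (r * X))) ≤ K ^ 2 * V i j ^ 2 + K ^ 2 * X ^ 2 := by
      intro r X hr
      have e1 : |q i j * r| ≤ K * K := by
        rw [abs_mul]; exact mul_le_mul h0 hr (abs_nonneg _) hK.le
      have e2 : 2 * (V i j * X) ≤ V i j ^ 2 + X ^ 2 := by nlinarith [sq_nonneg (V i j - X)]
      have e3 : -(V i j ^ 2 + X ^ 2) ≤ 2 * (V i j * X) := by nlinarith [sq_nonneg (V i j + X)]
      have e4 : |2 * (V i j * X)| ≤ V i j ^ 2 + X ^ 2 := abs_le.2 ⟨e3, e2⟩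
      calc _ = (q i j * r) * (2 * (V i j * X)) := by ring
        _ ≤ |q i j * r| * |2 * (V i j * X)| := by rw [← abs_mul]; exact le_abs_self _
        _ ≤ K * K * (V i j ^ 2 + X ^ 2) := mul_le_mul e1 e4 (abs_nonneg _) (by positivity)
        _ = _ := by ring
    have lin : ∀ X : ℝ, 2 * (V i j * (q i j * X)) ≤ 2 * K * (|V i j| * |X|) := by
      intro X
      calc _ = 2 * (q i j * (V i j * X)) := by ring
        _ ≤ 2 * (|q i j| * |V i j * X|) := by
          rw [← abs_mul]; linarith [le_abs_self (q i j * (V i j * X))]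
        _ ≤ 2 * (K * |V i j * X|) := by gcongr
        _ = _ := by rw [abs_mul]; ring
    have a1 := quad _ ((U (i + 1) j - U (i - 1) j) / (2 * Ω.stepX Mx)) h1
    have a2 := quad _ ((U i (j + 1) - U i (j - 1)) / (2 * Ω.stepY My)) h2
    have a3 := quad _ (U i j) h3
    have a4 := lin (f i j)
    have a5 := lin (g i j)
    linarith
  have hsum := mul_le_mul_of_nonneg_left
    (Finset.sum_le_sum fun i hi => Finset.sum_le_sum fun j hj => hpt i hi j hj) hh
  refine hsum.trans ?_
  simp only [Finset.sum_add_distrib, ← Finset.mul_sum]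
  have b1 := norm₂_sq Ω Mx My V
  have b2 := mul_le_mul_of_nonneg_left (sum_sq_centralX_le Ω Mx My U) (sq_nonneg K)
  have b3 := mul_le_mul_of_nonneg_left (sum_sq_centralY_le Ω Mx My U) (sq_nonneg K)
  have b4 := norm₂_sq Ω Mx My U
  have b5 := mul_le_mul_of_nonneg_left (norm₂_sq_le_normDx_sq Ω hMx My hU) (sq_nonneg K)
  have b6 := mul_le_mul_of_nonneg_left (sum_abs_mul_abs_le_norm₂ Ω Mx My V f)
    (show 0 ≤ 2 * K by positivity)
  have b7 := mul_le_mul_of_nonneg_left (sum_abs_mul_abs_le_norm₂ Ω Mx My V g)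
    (show 0 ≤ 2 * K by positivity)
  have b1' := congrArg (K ^ 2 * ·) b1
  have b4' := congrArg (K ^ 2 * ·) b4
  linarith

end Norms

/-! ### Monotonicity of the weights in time -/

theorem monotoneOn_exp_mul {f f' : ℝ → ℝ} {c T : ℝ}
    (hf : ∀ s ∈ Set.Icc 0 T, HasDerivWithinAt f (f' s) (Set.Icc 0 T) s)
    (hc : ∀ s ∈ Set.Icc 0 T, 0 ≤ c * f s + f' s) :
    MonotoneOn (fun s => Real.exp (c * s) * f s) (Set.Icc 0 T) := by
  have hd : ∀ s ∈ interior (Set.Icc 0 T), HasDerivAt (fun s => Real.exp (c * s) * f s)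
      (Real.exp (c * s) * (c * f s + f' s)) s := by
    intro s hs
    have hs' := interior_subset hs
    have h1 : HasDerivAt (fun s => Real.exp (c * s)) (Real.exp (c * s) * (c * 1)) s :=
      ((hasDerivAt_id s).const_mul c).exp
    have h2 := (hf s hs').hasDerivAt (mem_interior_iff_mem_nhds.1 hs)
    exact (h1.mul h2).congr_deriv (by ring)
  refine monotoneOn_of_deriv_nonneg (convex_Icc 0 T) ?_
    (fun s hs => (hd s hs).differentiableAt.differentiableWithinAt) fun s hs => ?_
  · have : ContinuousOn f (Set.Icc 0 T) := fun s hs => (hf s hs).continuousWithinAt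
    exact ContinuousOn.mul (by fun_prop) this
  · rw [(hd s hs).deriv]
    exact mul_nonneg (Real.exp_pos _).le (hc s (interior_subset hs))

theorem antitoneOn_const_mul_exp_div {f : ℝ → ℝ} {c T d : ℝ} (hd : 0 ≤ d)
    (hf : ∀ s ∈ Set.Icc 0 T, 0 < f s)
    (hmono : MonotoneOn (fun s => Real.exp (c * s) * f s) (Set.Icc 0 T)) :
    AntitoneOn (fun s => d * Real.exp (-c * s) / f s) (Set.Icc 0 T) := by
  have e : ∀ s, d * Real.exp (-c * s) / f s = d / (Real.exp (c * s) * f s) := by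
    intro s
    rw [show -c * s = -(c * s) by ring, Real.exp_neg, ← div_eq_mul_inv, div_div]
  intro s hs r hr hsr
  simp only [e]
  exact div_le_div_of_nonneg_left hd (mul_pos (Real.exp_pos _) (hf s hs)) (hmono hs hr hsr)

section Weights

variable {Ω : Rect} {T Cp m K : ℝ} {c : Coeffs} {d : ℝ → ℝ → ℝ} (hV : ConditionV1 Ω T c Cp)
  (hW : WeightBounds Ω T c d Cp m K) {x y : ℝ} (hxy : (x, y) ∈ Ω.interior)
include hV hxy

theorem ConditionV1.hasDerivWithinAt₁ {s : ℝ} (hs : s ∈ Set.Icc 0 T) :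
    HasDerivWithinAt (c.a₁ x y) (derivWithin (c.a₁ x y) (Set.Icc 0 T) s) (Set.Icc 0 T) s :=
  ((hV.smooth₁ x y hxy).differentiableOn (by norm_num) s hs).hasDerivWithinAt

theorem ConditionV1.hasDerivWithinAt₂ {s : ℝ} (hs : s ∈ Set.Icc 0 T) :
    HasDerivWithinAt (c.a₂ x y) (derivWithin (c.a₂ x y) (Set.Icc 0 T) s) (Set.Icc 0 T) s :=
  ((hV.smooth₂ x y hxy).differentiableOn (by norm_num) s hs).hasDerivWithinAt

theorem ConditionV1.abs_deriv_add_le {s : ℝ} (hs : s ∈ Set.Icc 0 T) :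
    |derivWithin (c.a₁ x y) (Set.Icc 0 T) s| * c.a₂ x y s
      + c.a₁ x y s * |derivWithin (c.a₂ x y) (Set.Icc 0 T) s|
        ≤ Cp * (c.a₁ x y s * c.a₂ x y s) := by
  have h1 := hV.pos₁ x y hxy s hs
  have h2 := hV.pos₂ x y hxy s hs
  have h3 := hV.bound x y hxy s hs
  rw [abs_div, abs_div, abs_of_pos h1, abs_of_pos h2, div_add_div _ _ h1.ne' h2.ne',
    div_le_iff₀ (mul_pos h1 h2)] at h3
  exact h3

include hW

/-- The logarithmic derivative of `p` is `-Cp - ∂ₜa₁ / a₁ - ∂ₜa₂ / a₂ ≤ 0`. -/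
theorem antitoneOn_p : AntitoneOn (p c d Cp x y) (Set.Icc 0 T) := by
  refine antitoneOn_const_mul_exp_div (f := fun s => c.a₁ x y s * c.a₂ x y s)
    (hW.d_pos x y hxy).le
    (fun s hs => mul_pos (hV.pos₁ x y hxy s hs) (hV.pos₂ x y hxy s hs))
    (monotoneOn_exp_mul
      (fun s hs => (hV.hasDerivWithinAt₁ hxy hs).mul (hV.hasDerivWithinAt₂ hxy hs))
      fun s hs => ?_)
  have h1 := hV.pos₁ x y hxy s hs
  have h2 := hV.pos₂ x y hxy s hs
  have h3 := hV.abs_deriv_add_le hxy hs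
  have h4 := mul_le_mul_of_nonneg_right
    (neg_abs_le (derivWithin (c.a₁ x y) (Set.Icc 0 T) s)) h2.le
  have h5 := mul_le_mul_of_nonneg_left
    (neg_abs_le (derivWithin (c.a₂ x y) (Set.Icc 0 T) s)) h1.le
  linarith

theorem antitoneOn_p₁ : AntitoneOn (p₁ c d Cp x y) (Set.Icc 0 T) := by
  refine antitoneOn_const_mul_exp_div (f := fun s => c.a₂ x y s) (hW.d_pos x y hxy).le
    (fun s hs => hV.pos₂ x y hxy s hs)
    (monotoneOn_exp_mul (fun s hs => hV.hasDerivWithinAt₂ hxy hs) fun s hs => ?_)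
  have h1 := hV.pos₁ x y hxy s hs
  have h2 := hV.pos₂ x y hxy s hs
  have h3 := hV.abs_deriv_add_le hxy hs
  have h4 := mul_nonneg (abs_nonneg (derivWithin (c.a₁ x y) (Set.Icc 0 T) s)) h2.le
  have h5 : |derivWithin (c.a₂ x y) (Set.Icc 0 T) s| ≤ Cp * c.a₂ x y s :=
    le_of_mul_le_mul_left (by linarith) h1
  linarith [neg_abs_le (derivWithin (c.a₂ x y) (Set.Icc 0 T) s)]

theorem antitoneOn_p₂ : AntitoneOn (p₂ c d Cp x y) (Set.Icc 0 T) := by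
  refine antitoneOn_const_mul_exp_div (f := fun s => c.a₁ x y s) (hW.d_pos x y hxy).le
    (fun s hs => hV.pos₁ x y hxy s hs)
    (monotoneOn_exp_mul (fun s hs => hV.hasDerivWithinAt₁ hxy hs) fun s hs => ?_)
  have h1 := hV.pos₁ x y hxy s hs
  have h2 := hV.pos₂ x y hxy s hs
  have h3 := hV.abs_deriv_add_le hxy hs
  have h4 := mul_nonneg h1.le (abs_nonneg (derivWithin (c.a₂ x y) (Set.Icc 0 T) s))
  have h5 : |derivWithin (c.a₁ x y) (Set.Icc 0 T) s| ≤ Cp * c.a₁ x y s :=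
    le_of_mul_le_mul_right (by linarith) h2
  linarith [neg_abs_le (derivWithin (c.a₁ x y) (Set.Icc 0 T) s)]

end Weights

/-! ### The energy estimate for the scheme -/

theorem Rect.nodeX_mem (Ω : Rect) {Mx : ℕ} {r : ℝ} (h0 : 0 < r) (h1 : r < Mx) :
    Ω.nodeX Mx r ∈ Set.Ioo Ω.xl Ω.xr := by
  have hM : (0 : ℝ) < Mx := h0.trans h1
  have hs : 0 < Ω.stepX Mx := Ω.stepX_pos (Nat.cast_pos.1 hM)
  have e : Mx * Ω.stepX Mx = Ω.xr - Ω.xl := by unfold Rect.stepX; field_simp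
  have := mul_lt_mul_of_pos_right h1 hs
  have := mul_pos h0 hs
  constructor <;> (unfold Rect.nodeX; linarith)

theorem Rect.nodeY_mem (Ω : Rect) {My : ℕ} {r : ℝ} (h0 : 0 < r) (h1 : r < My) :
    Ω.nodeY My r ∈ Set.Ioo Ω.yl Ω.yr := by
  have hM : (0 : ℝ) < My := h0.trans h1
  have hs : 0 < Ω.stepY My := Ω.stepY_pos (Nat.cast_pos.1 hM)
  have e : My * Ω.stepY My = Ω.yr - Ω.yl := by unfold Rect.stepY; field_simp
  have := mul_lt_mul_of_pos_right h1 hs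
  have := mul_pos h0 hs
  constructor <;> (unfold Rect.nodeY; linarith)

theorem cast_mem_Ioo_of_mem_Icc {M i : ℕ} (hi : i ∈ Finset.Icc 1 (M - 1)) :
    (0 : ℝ) < i ∧ (i : ℝ) < M := by
  rw [Finset.mem_Icc] at hi
  exact ⟨by exact_mod_cast (by omega : 0 < i), by exact_mod_cast (by omega : i < M)⟩

theorem half_mem_Ioo_of_mem_range {M i : ℕ} (hi : i ∈ Finset.range M) :
    (0 : ℝ) < i + 1 / 2 ∧ (i : ℝ) + 1 / 2 < M := by
  rw [Finset.mem_range] at hi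
  have h1 : (i : ℝ) + 1 ≤ M := by exact_mod_cast hi
  have h2 : (0 : ℝ) ≤ i := Nat.cast_nonneg i
  constructor <;> linarith

/-- A function vanishing on the boundary has a sample vanishing at the boundary nodes. -/
theorem Rect.VanishesOnBoundary.sample_eq_zero {Ω : Rect} {g : ℝ → ℝ → ℝ}
    (hg : Ω.VanishesOnBoundary g) {Mx My : ℕ} (hMx : 0 < Mx) (hMy : 0 < My) {i j : ℕ}
    (hi : i ≤ Mx) (hj : j ≤ My) (hb : i = 0 ∨ i = Mx ∨ j = 0 ∨ j = My) :
    Ω.sample Mx My g i j = 0 := by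
  have hMx' : (0 : ℝ) < Mx := Nat.cast_pos.2 hMx
  have hMy' : (0 : ℝ) < My := Nat.cast_pos.2 hMy
  have hsx := Ω.stepX_pos hMx
  have hsy := Ω.stepY_pos hMy
  have ex : Mx * Ω.stepX Mx = Ω.xr - Ω.xl := by unfold Rect.stepX; field_simp
  have ey : My * Ω.stepY My = Ω.yr - Ω.yl := by unfold Rect.stepY; field_simp
  have hix : (i : ℝ) * Ω.stepX Mx ≤ Mx * Ω.stepX Mx :=
    mul_le_mul_of_nonneg_right (Nat.cast_le.2 hi) hsx.le
  have hjy : (j : ℝ) * Ω.stepY My ≤ My * Ω.stepY My :=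
    mul_le_mul_of_nonneg_right (Nat.cast_le.2 hj) hsy.le
  have hi0 : 0 ≤ (i : ℝ) * Ω.stepX Mx := by positivity
  have hj0 : 0 ≤ (j : ℝ) * Ω.stepY My := by positivity
  refine hg _ ⟨?_, ?_⟩ _ ⟨?_, ?_⟩ ?_
  · unfold Rect.nodeX; linarith
  · unfold Rect.nodeX; linarith
  · unfold Rect.nodeY; linarith
  · unfold Rect.nodeY; linarith
  · rintro ⟨⟨h1, h2⟩, h3, h4⟩
    simp only [Rect.nodeX, Rect.nodeY] at h1 h2 h3 h4
    rcases hb with rfl | rfl | rfl | rfl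
    · simp at h1
    · linarith
    · simp at h3
    · linarith

section Mesh

variable {T β : ℝ} {N : ℕ} {t : ℕ → ℝ} (h : IsTimeMesh T N t) (hβ0 : 0 < β) (hβ : β < 1)
include h hβ0 hβ

theorem IsTimeMesh.offset_mono {k n : ℕ} (hk : k ≤ n) (hn : n ≤ N) :
    offset β t k ≤ offset β t n := by
  rcases eq_or_lt_of_le hk with rfl | hlt
  · exact le_rfl
  · exact (h.offset_le hβ0 (by omega)).trans ((h.mono (by omega : k ≤ n - 1) (by omega)).trans
      (h.lt_offset hβ (by omega) hn).le)

theorem IsTimeMesh.offset_mem {n : ℕ} (hn : n ≤ N) : offset β t n ∈ Set.Icc 0 T := by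
  refine ⟨?_, (h.offset_le hβ0 hn).trans (h.le_last hn)⟩
  have h1 := h.nonneg hn
  have h2 := h.nonneg (show n - 1 ≤ N by omega)
  have h3 : 0 ≤ 1 - β / 2 := by linarith
  unfold offset
  positivity

end Mesh

/-- The energy of a solution of the scheme at level `k`: that of `v^k` and `ũ^k`, with the weights
`p`, `p₁`, `p₂` at time `t_{k-θ}` (at time `0` for `k = 0`). -/
noncomputable def schemeEnergy (Ω : Rect) (c : Coeffs) (d : ℝ → ℝ → ℝ) (Cp β : ℝ) (Mx My : ℕ)
    (t : ℕ → ℝ) (v w : ℕ → ℕ → ℕ → ℝ) (k : ℕ) : ℝ :=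
  energy (Ω.stepX Mx) (Ω.stepY My) Mx My
    (fun i j => p c d Cp (Ω.nodeX Mx i) (Ω.nodeY My j) (offset β t k))
    (fun i j => p₁ c d Cp (Ω.nodeX Mx (i + 1 / 2)) (Ω.nodeY My j) (offset β t k))
    (fun i j => p₂ c d Cp (Ω.nodeX Mx i) (Ω.nodeY My (j + 1 / 2)) (offset β t k))
    (v k) (w k)

section Scheme

variable {Ω : Rect} {c : Coeffs} {d : ℝ → ℝ → ℝ} {T Cp m K β : ℝ} {Mx My N : ℕ} {t : ℕ → ℝ}

theorem mul_norms_le_schemeEnergy (hW : WeightBounds Ω T c d Cp m K) (h : IsTimeMesh T N t)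
    (hβ0 : 0 < β) (hβ : β < 1) (v w : ℕ → ℕ → ℕ → ℝ) {k : ℕ} (hk : k ≤ N) :
    m * (norm₂ Ω Mx My (v k) ^ 2 + normDx Ω Mx My (w k) ^ 2 + normDy Ω Mx My (w k) ^ 2)
      ≤ schemeEnergy Ω c d Cp β Mx My t v w k := by
  have hs := h.offset_mem hβ0 hβ hk
  refine mul_norms_le_energy Ω Mx My (v k) (w k) (fun i hi j hj => ?_) (fun i hi j hj => ?_)
    fun i hi j hj => ?_
  · have hi := cast_mem_Ioo_of_mem_Icc hi
    have hj := cast_mem_Ioo_of_mem_Icc hj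
    exact (hW.bound_p _ _ ⟨Ω.nodeX_mem hi.1 hi.2, Ω.nodeY_mem hj.1 hj.2⟩ _ hs).1
  · have hi := half_mem_Ioo_of_mem_range hi
    have hj := cast_mem_Ioo_of_mem_Icc hj
    exact (hW.bound_p₁ _ _ ⟨Ω.nodeX_mem hi.1 hi.2, Ω.nodeY_mem hj.1 hj.2⟩ _ hs).1
  · have hi := cast_mem_Ioo_of_mem_Icc hi
    have hj := half_mem_Ioo_of_mem_range hj
    exact (hW.bound_p₂ _ _ ⟨Ω.nodeX_mem hi.1 hi.2, Ω.nodeY_mem hj.1 hj.2⟩ _ hs).1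

theorem schemeEnergy_zero_le (hW : WeightBounds Ω T c d Cp m K) (h : IsTimeMesh T N t)
    (hβ0 : 0 < β) (hβ : β < 1) (v w : ℕ → ℕ → ℕ → ℝ)
    (hv : ∀ i ∈ Finset.Icc 1 (Mx - 1), ∀ j ∈ Finset.Icc 1 (My - 1), v 0 i j = 0) :
    schemeEnergy Ω c d Cp β Mx My t v w 0 ≤ K * normGrad Ω Mx My (w 0) ^ 2 := by
  have hs := h.offset_mem hβ0 hβ (Nat.zero_le N)
  refine energy_le_mul_normGrad_sq Ω Mx My (w 0) hv (fun i hi j hj => ?_) fun i hi j hj => ?_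
  · have hi := half_mem_Ioo_of_mem_range hi
    have hj := cast_mem_Ioo_of_mem_Icc hj
    exact (hW.bound_p₁ _ _ ⟨Ω.nodeX_mem hi.1 hi.2, Ω.nodeY_mem hj.1 hj.2⟩ _ hs).2
  · have hi := cast_mem_Ioo_of_mem_Icc hi
    have hj := half_mem_Ioo_of_mem_range hj
    exact (hW.bound_p₂ _ _ ⟨Ω.nodeX_mem hi.1 hi.2, Ω.nodeY_mem hj.1 hj.2⟩ _ hs).2

/-- The energy inequality of the scheme, before the norms at `t_{n-θ}` are estimated by the
energies at the levels `n - 1` and `n`. -/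
theorem discreteCaputo_schemeEnergy_le (hβ0 : 0 < β) (hβ : β < 1) (hm : 0 < m) (hK : 0 < K)
    (hV1 : ConditionV1 Ω T c Cp) (hW : WeightBounds Ω T c d Cp m K) (hMx : 0 < Mx) (hMy : 0 < My)
    (h : IsTimeMesh T N t) (hρ : ∀ k, 1 ≤ k → k + 1 ≤ N → stepRatio t k ≤ 7 / 4)
    {f : ℝ → ℝ → ℝ → ℝ} {φ ψ : ℝ → ℝ → ℝ} (hψ : Ω.VanishesOnBoundary ψ)
    {u v : ℕ → ℕ → ℕ → ℝ} (hS : IsSchemeSolution Ω c d Cp β Mx My N t f φ ψ u v)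
    {n : ℕ} (hn0 : 1 ≤ n) (hn : n ≤ N) {U V : ℕ → ℕ → ℝ}
    (hU : U = fun i j => offset β (fun k => shifted Ω Mx My t ψ u k i j) n)
    (hV : V = fun i j => offset β (fun k => v k i j) n) :
    discreteCaputo β t (schemeEnergy Ω c d Cp β Mx My t v (shifted Ω Mx My t ψ u)) n
      ≤ K ^ 2 * (3 * norm₂ Ω Mx My V ^ 2 + (1 + (Ω.xr - Ω.xl) ^ 2) * normDx Ω Mx My U ^ 2
          + normDy Ω Mx My U ^ 2)
        + 2 * K * (norm₂ Ω Mx My V * (norm₂ Ω Mx My (source Ω Mx My β t f n)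
          + norm₂ Ω Mx My (sourcePsi Ω Mx My β t c ψ n))) := by
  have hs : ∀ k ≤ n, offset β t k ∈ Set.Icc 0 T := fun k hk =>
    h.offset_mem hβ0 hβ (hk.trans hn)
  have hmono : ∀ k ≤ n, offset β t k ≤ offset β t n := fun k hk => h.offset_mono hβ0 hβ hk hn
  have hw0 : ∀ k ≤ N, ∀ i ≤ Mx, ∀ j ≤ My, (i = 0 ∨ i = Mx ∨ j = 0 ∨ j = My) →
      shifted Ω Mx My t ψ u k i j = 0 := by
    intro k hk i hi j hj hb
    rw [shifted, hS.boundary_u k hk i hi j hj hb, hψ.sample_eq_zero hMx hMy hi hj hb]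
    ring
  have hV0 : ∀ i ≤ Mx, ∀ j ≤ My, (i = 0 ∨ i = Mx ∨ j = 0 ∨ j = My) → V i j = 0 := by
    intro i hi j hj hb
    rw [hV]
    simp only [offset]
    rw [hS.boundary_v n hn i hi j hj hb, hS.boundary_v (n - 1) (by omega) i hi j hj hb]
    ring
  have hVw : ∀ i ≤ Mx, ∀ j ≤ My,
      V i j = discreteCaputo β t (fun k => shifted Ω Mx My t ψ u k i j) n := by
    intro i hi j hj
    by_cases hb : i = 0 ∨ i = Mx ∨ j = 0 ∨ j = My
    · rw [hV0 i hi j hj hb, discreteCaputo_congr (g := fun _ => 0)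
        fun k hk => hw0 k (hk.trans hn) i hi j hj hb]
      simp [discreteCaputo]
    · rw [hV]
      exact hS.eq_u n ⟨hn0, hn⟩ i ⟨by omega, by omega⟩ j ⟨by omega, by omega⟩
  have hU0 : ∀ j ∈ Finset.Icc 1 (My - 1), U 0 j = 0 := by
    intro j hj
    rw [Finset.mem_Icc] at hj
    rw [hU]
    simp only [offset]
    rw [hw0 n hn 0 (by omega) j (by omega) (by omega),
      hw0 (n - 1) (by omega) 0 (by omega) j (by omega) (by omega)]
    ring
  have henergy := discreteCaputo_energy_le h hβ0 hβ hρ (Ω.stepX_pos hMx) (Ω.stepY_pos hMy) hMx hMy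
    (q := fun k i j => p c d Cp (Ω.nodeX Mx i) (Ω.nodeY My j) (offset β t k))
    (q₁ := fun k i j => p₁ c d Cp (Ω.nodeX Mx (i + 1 / 2)) (Ω.nodeY My j) (offset β t k))
    (q₂ := fun k i j => p₂ c d Cp (Ω.nodeX Mx i) (Ω.nodeY My (j + 1 / 2)) (offset β t k))
    (v := v) (w := shifted Ω Mx My t ψ u) hn0 hn
    (fun i hi j hj => by
      have hi := cast_mem_Ioo_of_mem_Icc hi
      have hj := cast_mem_Ioo_of_mem_Icc hj
      have hz : (Ω.nodeX Mx i, Ω.nodeY My j) ∈ Ω.interior :=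
        ⟨Ω.nodeX_mem hi.1 hi.2, Ω.nodeY_mem hj.1 hj.2⟩
      exact ⟨hm.le.trans (hW.bound_p _ _ hz _ (hs n le_rfl)).1, fun k hk =>
        antitoneOn_p hV1 hW hz (hs k hk) (hs n le_rfl) (hmono k hk)⟩)
    (fun i hi j hj => by
      have hi := half_mem_Ioo_of_mem_range hi
      have hj := cast_mem_Ioo_of_mem_Icc hj
      have hz : (Ω.nodeX Mx (i + 1 / 2), Ω.nodeY My j) ∈ Ω.interior :=
        ⟨Ω.nodeX_mem hi.1 hi.2, Ω.nodeY_mem hj.1 hj.2⟩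
      exact ⟨hm.le.trans (hW.bound_p₁ _ _ hz _ (hs n le_rfl)).1, fun k hk =>
        antitoneOn_p₁ hV1 hW hz (hs k hk) (hs n le_rfl) (hmono k hk)⟩)
    (fun i hi j hj => by
      have hi := cast_mem_Ioo_of_mem_Icc hi
      have hj := half_mem_Ioo_of_mem_range hj
      have hz : (Ω.nodeX Mx i, Ω.nodeY My (j + 1 / 2)) ∈ Ω.interior :=
        ⟨Ω.nodeX_mem hi.1 hi.2, Ω.nodeY_mem hj.1 hj.2⟩
      exact ⟨hm.le.trans (hW.bound_p₂ _ _ hz _ (hs n le_rfl)).1, fun k hk =>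
        antitoneOn_p₂ hV1 hW hz (hs k hk) (hs n le_rfl) (hmono k hk)⟩)
    (U := U) (V := V) (fun i j => by rw [hU]) (fun i j => by rw [hV]) hVw hV0
  refine henergy.trans ?_
  refine le_trans (le_of_eq ?_) (sum_lower_order_le Ω hMx My hK
    (q := fun i j => p c d Cp (Ω.nodeX Mx i) (Ω.nodeY My j) (offset β t n))
    (r₁ := fun i j => p₃ c d Cp (Ω.nodeX Mx i) (Ω.nodeY My j) (offset β t n))
    (r₂ := fun i j => p₄ c d Cp (Ω.nodeX Mx i) (Ω.nodeY My j) (offset β t n))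
    (r₃ := fun i j => c.b₃ (Ω.nodeX Mx i) (Ω.nodeY My j) (offset β t n))
    (U := U) (V := V) (f := source Ω Mx My β t f n) (g := sourcePsi Ω Mx My β t c ψ n) hU0 ?_)
  · congr 1
    refine Finset.sum_congr rfl fun i hi => Finset.sum_congr rfl fun j hj => ?_
    have hi' := cast_mem_Ioo_of_mem_Icc hi
    have hj' := cast_mem_Ioo_of_mem_Icc hj
    have hz : (Ω.nodeX Mx i, Ω.nodeY My j) ∈ Ω.interior :=
      ⟨Ω.nodeX_mem hi'.1 hi'.2, Ω.nodeY_mem hj'.1 hj'.2⟩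
    have hp : p c d Cp (Ω.nodeX Mx i) (Ω.nodeY My j) (offset β t n) ≠ 0 :=
      (hm.trans_le (hW.bound_p _ _ hz _ (hs n le_rfl)).1).ne'
    rw [Finset.mem_Icc] at hi hj
    have heq := hS.eq_v n ⟨hn0, hn⟩ i ⟨by omega, by omega⟩ j ⟨by omega, by omega⟩
    have ei : ((i - 1 : ℕ) : ℝ) + 1 / 2 = i - 1 / 2 := by
      rw [Nat.cast_sub hi.1]; push_cast; ring
    have ej : ((j - 1 : ℕ) : ℝ) + 1 / 2 = j - 1 / 2 := by
      rw [Nat.cast_sub hj.1]; push_cast; ring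
    have e1 : ∀ i j, offset β (fun k => shifted Ω Mx My t ψ u k i j) n = U i j := fun i j => by
      rw [hU]
    simp only [e1, discreteOp] at heq
    simp only [heq, ei, ej, show i - 1 + 1 = i by omega, show j - 1 + 1 = j by omega]
    field_simp
    ring
  · intro i hi j hj
    have hi := cast_mem_Ioo_of_mem_Icc hi
    have hj := cast_mem_Ioo_of_mem_Icc hj
    have hz : (Ω.nodeX Mx i, Ω.nodeY My j) ∈ Ω.interior :=
      ⟨Ω.nodeX_mem hi.1 hi.2, Ω.nodeY_mem hj.1 hj.2⟩
    have hp := hW.bound_p _ _ hz _ (hs n le_rfl)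
    refine ⟨?_, hW.bound_p₃ _ _ hz _ (hs n le_rfl), hW.bound_p₄ _ _ hz _ (hs n le_rfl),
      hW.bound_b₃ _ _ hz _ (hs n le_rfl)⟩
    rw [abs_of_pos (hm.trans_le hp.1)]
    exact hp.2

/-- The energy inequality in the form required by the discrete fractional Grönwall inequality. -/
theorem discreteCaputo_schemeEnergy_le_max (hβ0 : 0 < β) (hβ : β < 1) (hm : 0 < m) (hK : 0 < K)
    (hV1 : ConditionV1 Ω T c Cp) (hW : WeightBounds Ω T c d Cp m K) (hMx : 0 < Mx) (hMy : 0 < My)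
    (h : IsTimeMesh T N t) (hρ : ∀ k, 1 ≤ k → k + 1 ≤ N → stepRatio t k ≤ 7 / 4)
    {f : ℝ → ℝ → ℝ → ℝ} {φ ψ : ℝ → ℝ → ℝ} (hψ : Ω.VanishesOnBoundary ψ)
    {u v : ℕ → ℕ → ℕ → ℝ} (hS : IsSchemeSolution Ω c d Cp β Mx My N t f φ ψ u v)
    {y : ℕ → ℝ}
    (hy : y = fun k => √(schemeEnergy Ω c d Cp β Mx My t v (shifted Ω Mx My t ψ u) k))
    {n : ℕ} (hn0 : 1 ≤ n) (hn : n ≤ N) :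
    discreteCaputo β t (fun k => y k ^ 2) n
      ≤ K ^ 2 * (5 + (Ω.xr - Ω.xl) ^ 2) / m * max (y n) (y (n - 1)) ^ 2
        + 2 * K / √m * max (y n) (y (n - 1)) * (norm₂ Ω Mx My (source Ω Mx My β t f n)
          + norm₂ Ω Mx My (sourcePsi Ω Mx My β t c ψ n)) := by
  obtain ⟨w, hw⟩ : ∃ w, w = shifted Ω Mx My t ψ u := ⟨_, rfl⟩
  rw [← hw] at hy
  have hE : ∀ k ≤ N, m * (norm₂ Ω Mx My (v k) ^ 2 + normDx Ω Mx My (w k) ^ 2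
      + normDy Ω Mx My (w k) ^ 2) ≤ schemeEnergy Ω c d Cp β Mx My t v w k := fun k hk =>
    mul_norms_le_schemeEnergy hW h hβ0 hβ v w hk
  have hysq : ∀ k ≤ N, y k ^ 2 = schemeEnergy Ω c d Cp β Mx My t v w k := fun k hk => by
    rw [hy]
    exact Real.sq_sqrt ((by positivity : 0 ≤ m * (norm₂ Ω Mx My (v k) ^ 2
      + normDx Ω Mx My (w k) ^ 2 + normDy Ω Mx My (w k) ^ 2)).trans (hE k hk))
  have hy0 : ∀ k, 0 ≤ y k := fun k => by rw [hy]; exact Real.sqrt_nonneg _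
  obtain ⟨X, hX⟩ : ∃ X, X = max (y n) (y (n - 1)) := ⟨_, rfl⟩
  have hX0 : 0 ≤ X := hX ▸ le_max_of_le_left (hy0 n)
  rw [← hX, discreteCaputo_congr fun k hk => hysq k (hk.trans hn)]
  have hXsq : ∀ k, k = n ∨ k = n - 1 →
      m * (norm₂ Ω Mx My (v k) ^ 2 + normDx Ω Mx My (w k) ^ 2 + normDy Ω Mx My (w k) ^ 2)
        ≤ X ^ 2 := by
    intro k hk
    have hkN : k ≤ N := by omega
    refine ((hE k hkN).trans_eq (hysq k hkN).symm).trans ?_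
    refine pow_le_pow_left₀ (hy0 k) ?_ 2
    rw [hX]
    rcases hk with rfl | rfl
    · exact le_max_left _ _
    · exact le_max_right _ _
  obtain ⟨U, hU⟩ : ∃ U : ℕ → ℕ → ℝ, U = fun i j => offset β (fun k => w k i j) n := ⟨_, rfl⟩
  obtain ⟨V, hV⟩ : ∃ V : ℕ → ℕ → ℝ, V = fun i j => offset β (fun k => v k i j) n := ⟨_, rfl⟩
  have hmain := discreteCaputo_schemeEnergy_le hβ0 hβ hm hK hV1 hW hMx hMy h hρ hψ hS hn0 hn
    (U := U) (by rw [hU, hw]) hV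
  rw [← hw] at hmain
  have hθ : 0 ≤ 1 - β / 2 := by linarith
  have hθ' : 0 ≤ β / 2 := by linarith
  -- the squared norms are convex, and `t_{n-θ}` is a convex combination
  have hVn : m * norm₂ Ω Mx My V ^ 2 ≤ X ^ 2 := by
    have h1 := norm₂_sq_combination_le Ω Mx My hθ hθ' (v n) (v (n - 1))
    rw [sub_add_cancel, one_mul] at h1
    have h2 := hXsq n (Or.inl rfl)
    have h3 := hXsq (n - 1) (Or.inr rfl)
    have h4 : m * norm₂ Ω Mx My (v n) ^ 2 ≤ X ^ 2 := by
      nlinarith [sq_nonneg (normDx Ω Mx My (w n)), sq_nonneg (normDy Ω Mx My (w n))]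
    have h5 : m * norm₂ Ω Mx My (v (n - 1)) ^ 2 ≤ X ^ 2 := by
      nlinarith [sq_nonneg (normDx Ω Mx My (w (n - 1))), sq_nonneg (normDy Ω Mx My (w (n - 1)))]
    have h6 := mul_le_mul_of_nonneg_left h1 hm.le
    have h7 := mul_le_mul_of_nonneg_left h4 hθ
    have h8 := mul_le_mul_of_nonneg_left h5 hθ'
    rw [hV]
    simp only [offset]
    linarith
  have hUx : m * normDx Ω Mx My U ^ 2 ≤ X ^ 2 := by
    have h1 := normDx_sq_combination_le Ω Mx My hθ hθ' (w n) (w (n - 1))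
    rw [sub_add_cancel, one_mul] at h1
    have h2 := hXsq n (Or.inl rfl)
    have h3 := hXsq (n - 1) (Or.inr rfl)
    have h4 : m * normDx Ω Mx My (w n) ^ 2 ≤ X ^ 2 := by
      nlinarith [sq_nonneg (norm₂ Ω Mx My (v n)), sq_nonneg (normDy Ω Mx My (w n))]
    have h5 : m * normDx Ω Mx My (w (n - 1)) ^ 2 ≤ X ^ 2 := by
      nlinarith [sq_nonneg (norm₂ Ω Mx My (v (n - 1))), sq_nonneg (normDy Ω Mx My (w (n - 1)))]
    have h6 := mul_le_mul_of_nonneg_left h1 hm.le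
    have h7 := mul_le_mul_of_nonneg_left h4 hθ
    have h8 := mul_le_mul_of_nonneg_left h5 hθ'
    rw [hU]
    simp only [offset]
    linarith
  have hUy : m * normDy Ω Mx My U ^ 2 ≤ X ^ 2 := by
    have h1 := normDy_sq_combination_le Ω Mx My hθ hθ' (w n) (w (n - 1))
    rw [sub_add_cancel, one_mul] at h1
    have h2 := hXsq n (Or.inl rfl)
    have h3 := hXsq (n - 1) (Or.inr rfl)
    have h4 : m * normDy Ω Mx My (w n) ^ 2 ≤ X ^ 2 := by
      nlinarith [sq_nonneg (norm₂ Ω Mx My (v n)), sq_nonneg (normDx Ω Mx My (w n))]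
    have h5 : m * normDy Ω Mx My (w (n - 1)) ^ 2 ≤ X ^ 2 := by
      nlinarith [sq_nonneg (norm₂ Ω Mx My (v (n - 1))), sq_nonneg (normDx Ω Mx My (w (n - 1)))]
    have h6 := mul_le_mul_of_nonneg_left h1 hm.le
    have h7 := mul_le_mul_of_nonneg_left h4 hθ
    have h8 := mul_le_mul_of_nonneg_left h5 hθ'
    rw [hU]
    simp only [offset]
    linarith
  have hVsqrt : norm₂ Ω Mx My V ≤ X / √m := by
    rw [le_div_iff₀ (Real.sqrt_pos.2 hm)]
    refine abs_le_of_sq_le_sq' ?_ hX0 |>.2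
    rw [mul_pow, Real.sq_sqrt hm.le, mul_comm]
    exact hVn
  refine hmain.trans ?_
  have hg0 : 0 ≤ norm₂ Ω Mx My (source Ω Mx My β t f n)
      + norm₂ Ω Mx My (sourcePsi Ω Mx My β t c ψ n) :=
    add_nonneg (Real.sqrt_nonneg _) (Real.sqrt_nonneg _)
  have h1 := mul_le_mul_of_nonneg_left (mul_le_mul_of_nonneg_right hVsqrt hg0)
    (show 0 ≤ 2 * K by positivity)
  have h2 : 3 * norm₂ Ω Mx My V ^ 2 + (1 + (Ω.xr - Ω.xl) ^ 2) * normDx Ω Mx My U ^ 2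
      + normDy Ω Mx My U ^ 2 ≤ (5 + (Ω.xr - Ω.xl) ^ 2) / m * X ^ 2 := by
    rw [div_mul_eq_mul_div, le_div_iff₀ hm]
    nlinarith [mul_le_mul_of_nonneg_left hUx (sq_nonneg (Ω.xr - Ω.xl))]
  have h3 := mul_le_mul_of_nonneg_left h2 (sq_nonneg K)
  refine (add_le_add h3 h1).trans (le_of_eq ?_)
  ring

end Scheme

end DiffusionWave

open DiffusionWave

theorem theorem4p1 (α : ℝ) (hα : α ∈ Set.Ioo (1 : ℝ) 2) (T : ℝ) (hT : 0 < T) (Ω : Rect)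
    (m K : ℝ) (hm : 0 < m) (hK : 0 < K) :
    ∃ τmax > 0, ∃ C₁ > 0, ∃ C₂ > 0,
      ∀ (c : Coeffs) (d : ℝ → ℝ → ℝ) (Cp : ℝ), 0 < Cp →
        ConditionV1 Ω T c Cp → WeightBounds Ω T c d Cp m K →
      ∀ (Mx My N : ℕ) (t : ℕ → ℝ), 0 < Mx → 0 < My → IsTimeMesh T N t →
        (∀ k, 1 ≤ k → k + 1 ≤ N → stepRatio t k ≤ 7 / 4) →
        (∀ k ∈ Set.Icc 1 N, step t k ≤ τmax) →
      ∀ (f : ℝ → ℝ → ℝ → ℝ) (φ ψ : ℝ → ℝ → ℝ),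
        Ω.VanishesOnBoundary φ → Ω.VanishesOnBoundary ψ → HasSecondPartials Ω ψ →
      ∀ u v : ℕ → ℕ → ℕ → ℝ,
        IsSchemeSolution Ω c d Cp (α / 2) Mx My N t f φ ψ u v →
      ∀ (n : ℕ) (hn : 1 ≤ n), n ≤ N →
        normGrad Ω Mx My (u n)
          ≤ C₁ * (normGrad Ω Mx My (Ω.sample Mx My φ)
              + t n * normGrad Ω Mx My (Ω.sample Mx My ψ)
              + maxUpTo n hn fun k => ∑ j ∈ Finset.Icc 1 k, kernelP (α / 2) t k j *
                  (norm₂ Ω Mx My (source Ω Mx My (α / 2) t f j)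
                    + norm₂ Ω Mx My (sourcePsi Ω Mx My (α / 2) t c ψ j))) ∧
        C₁ * (normGrad Ω Mx My (Ω.sample Mx My φ)
              + t n * normGrad Ω Mx My (Ω.sample Mx My ψ)
              + maxUpTo n hn fun k => ∑ j ∈ Finset.Icc 1 k, kernelP (α / 2) t k j *
                  (norm₂ Ω Mx My (source Ω Mx My (α / 2) t f j)
                    + norm₂ Ω Mx My (sourcePsi Ω Mx My (α / 2) t c ψ j)))
          ≤ C₂ * (normGrad Ω Mx My (Ω.sample Mx My φ)
              + t n * normGrad Ω Mx My (Ω.sample Mx My ψ)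
              + maxUpTo n hn fun k => t k ^ (α / 2) *
                  (norm₂ Ω Mx My (source Ω Mx My (α / 2) t f k)
                    + norm₂ Ω Mx My (sourcePsi Ω Mx My (α / 2) t c ψ k))) := by
  have hβ0 : 0 < α / 2 := by linarith [hα.1]
  have hβ : α / 2 < 1 := by linarith [hα.2]
  have hΓ := Real.Gamma_pos_of_pos (show 0 < 1 - α / 2 by linarith)
  have hsm := Real.sqrt_pos.2 hm
  obtain ⟨τmax, hτmax, C, hC, hgron⟩ := discrete_fractional_gronwall (β := α / 2) (T := T)
    (Λ := K ^ 2 * (5 + (Ω.xr - Ω.xl) ^ 2) / m) (γ := 2 * K / √m) hβ0 hβ (by positivity)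
    (by positivity)
  refine ⟨τmax, hτmax, 2 * (1 + C / √m * (1 + √K)), by positivity,
    2 * (1 + C / √m * (1 + √K)) * (1 + Real.Gamma (1 - α / 2)), by positivity, ?_⟩
  intro c d Cp _ hV1 hW Mx My N t hMx hMy h hρ hτ f φ ψ hφ hψ _ u v hS n hn hnN
  have hφ0 : 0 ≤ normGrad Ω Mx My (Ω.sample Mx My φ) := Real.sqrt_nonneg _
  have hψ0 : 0 ≤ t n * normGrad Ω Mx My (Ω.sample Mx My ψ) :=
    mul_nonneg (h.nonneg hnN) (Real.sqrt_nonneg _)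
  obtain ⟨g, hg⟩ : ∃ g : ℕ → ℝ, g = fun j => norm₂ Ω Mx My (source Ω Mx My (α / 2) t f j)
    + norm₂ Ω Mx My (sourcePsi Ω Mx My (α / 2) t c ψ j) := ⟨_, rfl⟩
  have hg0 : ∀ k, 0 ≤ g k := fun k => by
    rw [hg]; exact add_nonneg (Real.sqrt_nonneg _) (Real.sqrt_nonneg _)
  have hge : ∀ j, norm₂ Ω Mx My (source Ω Mx My (α / 2) t f j)
    + norm₂ Ω Mx My (sourcePsi Ω Mx My (α / 2) t c ψ j) = g j := fun j => by rw [hg]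
  simp only [hge]
  obtain ⟨G, hG⟩ : ∃ G, G = maxUpTo n hn fun k => ∑ j ∈ Finset.Icc 1 k,
    kernelP (α / 2) t k j * g j := ⟨_, rfl⟩
  obtain ⟨G', hG'⟩ : ∃ G', G' = maxUpTo n hn fun k => t k ^ (α / 2) * g k := ⟨_, rfl⟩
  have hGG' : G ≤ Real.Gamma (1 - α / 2) * G' := by
    rw [hG, hG']; exact maxUpTo_sum_kernelP_le h hβ0 hβ hρ g hg0 hn hnN
  have hG0 : 0 ≤ G := by
    rw [hG]
    refine le_trans (Finset.sum_nonneg fun j hj => ?_) (le_maxUpTo hn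
      (fun k => ∑ j ∈ Finset.Icc 1 k, kernelP (α / 2) t k j * g j) hn le_rfl)
    rw [Finset.mem_Icc] at hj
    exact mul_nonneg (kernelP_nonneg h hβ0 hβ hρ hj.1 hj.2 hnN) (hg0 j)
  have hG'0 : 0 ≤ G' := by
    rw [hG']
    exact le_trans (mul_nonneg (Real.rpow_nonneg (h.nonneg hnN) _) (hg0 n))
      (le_maxUpTo hn (fun k => t k ^ (α / 2) * g k) hn le_rfl)
  rw [← hG, ← hG']
  constructor
  · obtain ⟨w, hw⟩ : ∃ w, w = shifted Ω Mx My t ψ u := ⟨_, rfl⟩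
    obtain ⟨y, hy⟩ : ∃ y : ℕ → ℝ,
      y = fun k => √(schemeEnergy Ω c d Cp (α / 2) Mx My t v w k) := ⟨_, rfl⟩
    have h1 := hgron N t h hρ hτ y g (fun k => by rw [hy]; exact Real.sqrt_nonneg _) hg0
      (fun k hk0 hk => by
        rw [hg]
        exact discreteCaputo_schemeEnergy_le_max hβ0 hβ hm hK hV1 hW hMx hMy h hρ hψ hS
          (by rw [hy, hw]) hk0 hk) n hn hnN
    rw [← hG] at h1
    have h2 : √m * normGrad Ω Mx My (w n) ≤ y n := by
      rw [hy]
      refine Real.le_sqrt_of_sq_le ?_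
      rw [mul_pow, Real.sq_sqrt hm.le, normGrad_sq]
      refine le_trans ?_ (mul_norms_le_schemeEnergy hW h hβ0 hβ v w hnN)
      nlinarith [sq_nonneg (norm₂ Ω Mx My (v n))]
    have h3 : y 0 ≤ √K * normGrad Ω Mx My (Ω.sample Mx My φ) := by
      have e : normGrad Ω Mx My (w 0) = normGrad Ω Mx My (Ω.sample Mx My φ) := by
        refine normGrad_congr fun i hi j hj => ?_
        rw [hw, shifted, h.zero, zero_mul, sub_zero]
        by_cases hb : i = 0 ∨ i = Mx ∨ j = 0 ∨ j = My
        · rw [hS.boundary_u 0 (Nat.zero_le N) i hi j hj hb,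
            hφ.sample_eq_zero hMx hMy hi hj hb]
        · exact hS.initial_u i ⟨by omega, by omega⟩ j ⟨by omega, by omega⟩
      rw [hy, ← e]
      refine Real.sqrt_le_iff.2 ⟨mul_nonneg (Real.sqrt_nonneg _) (Real.sqrt_nonneg _), ?_⟩
      rw [mul_pow, Real.sq_sqrt hK.le]
      refine schemeEnergy_zero_le hW h hβ0 hβ v w fun i hi j hj => ?_
      rw [Finset.mem_Icc] at hi hj
      exact hS.initial_v i ⟨by omega, by omega⟩ j ⟨by omega, by omega⟩
    have h4 : normGrad Ω Mx My (u n)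
        ≤ 2 * (normGrad Ω Mx My (w n) + t n * normGrad Ω Mx My (Ω.sample Mx My ψ)) := by
      refine le_trans (le_of_eq ?_) (normGrad_add_mul_le Ω Mx My (h.nonneg hnN) _ _)
      refine normGrad_congr fun i _ j _ => ?_
      rw [hw, shifted]
      ring
    have h5 : normGrad Ω Mx My (w n)
        ≤ C / √m * (√K * normGrad Ω Mx My (Ω.sample Mx My φ) + G) := by
      rw [div_mul_eq_mul_div, le_div_iff₀ hsm, mul_comm]
      refine h2.trans (h1.trans (mul_le_mul_of_nonneg_left ?_ hC.le))
      linarith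
    refine h4.trans ?_
    have hB : 0 ≤ C / √m := by positivity
    have hKs := Real.sqrt_nonneg K
    generalize C / √m = B at h5 hB ⊢
    generalize normGrad Ω Mx My (Ω.sample Mx My φ) = Φ at h5 hφ0 ⊢
    generalize t n * normGrad Ω Mx My (Ω.sample Mx My ψ) = Ψ at hψ0 ⊢
    have e1 := mul_nonneg hB hφ0
    have e2 := mul_nonneg (mul_nonneg hB hKs) hψ0
    have e3 := mul_nonneg (mul_nonneg hB hKs) hG0
    have e4 := mul_nonneg hB hψ0
    linarith
  · rw [mul_assoc (2 * (1 + C / √m * (1 + √K)))]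
    refine mul_le_mul_of_nonneg_left ?_ (by positivity)
    nlinarith [mul_nonneg hΓ.le hφ0, mul_nonneg hΓ.le hψ0]
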